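/- **Setting.** Let $G=(V,E,w)$ be a finite loopless undirected multigraph with $m=|E|$ edges, weights $w:E\to\mathbb R$, and totally ordered vertex labels. A cycle has length $\ge 2$ (two parallel edges form a cycle of length $2$); the girth of $G$ is the length of its shortest cycle ($\infty$ if there is none). Let $\mathrm{OPT}$ be the maximum weight of a forest (acyclic edge set) in $G$. The edges arrive one at a time in a uniformly random order $e_1,\dots,e_m$, and each must be irrevocably accepted or rejected on arrival, the accepted edges always forming a forest. An algorithm with (random) set of accepted edges $A$ is $c$-competitive ($c\ge 1$) on a family of graphs if $c\cdot\mathbb E[w(A)]\ge \mathrm{OPT}$ for every graph in the family. For an integer $g\ge 2$, let $x_g$ be the root in $[0,1]$ of $1-x-x^{g-1}$. **Algorithm (with parameter $g$).** Fix a rule that assigns to each set $S$ of observed edges a maximum weight forest $T(S)\subseteq S$. Start with $A^*=A=\emptyset$ and with no vertex having selected an edge. The first $\lfloor m/\mathrm e\rfloor$ edges are only observed. When a later edge $e_t$ arrives, let $T=T(\{e_1,\dots,e_t\})$. If $e_t\in T$, direct $e_t=(u,v)$ towards the vertex with the smallest label in its component of $T$. If $u$ has not yet selected an edge, then $u$ selects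 $e_t$, and $e_t$ is added to $A^*$; moreover, if $e_t$ closes a cycle in $A^*$, then $e_t$ is added to $A$ exactly if it closes no cycle in $A$, and otherwise $e_t$ is added to $A$ with probability $x_g$, independently of everything else. In all other cases $e_t$ is rejected. **Theorem.** 1. For every $g\ge2$, the polynomial $1-x-x^{g-1}$ has exactly one root $x_g$ in $[0,1]$. 2. For every $g\ge 2$ and every choice of the rule $T$, the set $A$ is a forest at all times, and the algorithm is $\frac{\mathrm e}{x_g}$-competitive on the graphs of girth at least $g$. 3. For every $g\ge2$, $x_g\ge 1-\frac{\ln g}{g-1}$; for all sufficiently large $g$, $x_g\le 1-\frac1{g-1}$. Hence $x_g\to1$ and $\mathrm e/x_g\to \mathrm e$ as $g\to\infty$. 4. Consequently there is a function $\delta(g)=o(1)$ as $g\to\infty$, depending only on $g$ and with $\delta(g)<1$, such that for every $g\ge2$ the algorithm satisfies $\mathbb E[w(A)]\ge\frac1{\mathrm e}(1-\delta(g))\,\mathrm{OPT}$ on every graph of girth at least $g$. -/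

import Mathlib

open Filter Topology Asymptotics

universe u v

noncomputable section

namespace GraphicSecretary

variable {α : Type u} {β : Type v}

/-- `IsCycle G k x c`: the edges `c 0, …, c (k - 1)` form a cycle of length `k ≥ 2` in the
multigraph `G`, passing through the distinct vertices `x 0, …, x (k - 1)` and back to `x k = x 0`.
The edges are pairwise distinct, so two parallel edges form a cycle of length two. -/
structure IsCycle (G : Graph α β) (k : ℕ) (x : ℕ → α) (c : ℕ → β) : Prop where
  two_le : 2 ≤ k
  closed : x k = x 0
  isLink : ∀ i < k, G.IsLink (c i) (x i) (x (i + 1))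
  vertex_inj : Set.InjOn x (Set.Iio k)
  edge_inj : Set.InjOn c (Set.Iio k)

/-- Every cycle of `G` has length at least `g` (a graph without cycles has infinite girth). -/
def GirthAtLeast (G : Graph α β) (g : ℕ) : Prop :=
  ∀ (k : ℕ) (x : ℕ → α) (c : ℕ → β), IsCycle G k x c → g ≤ k

/-- `F` is independent in the graphic matroid: it contains all the edges of no cycle. -/
def IsForest (G : Graph α β) (F : Finset β) : Prop :=
  ∀ (k : ℕ) (x : ℕ → α) (c : ℕ → β), IsCycle G k x c → ∃ i < k, c i ∉ F

/-- Adding the edge `e` to `F` creates a cycle: there is a cycle through `e` all of whose other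
edges belong to `F`. -/
def ClosesCycle (G : Graph α β) (F : Finset β) (e : β) : Prop :=
  ∃ (k : ℕ) (x : ℕ → α) (c : ℕ → β), IsCycle G k x c ∧
    (∀ i < k, c i = e ∨ c i ∈ F) ∧ ∃ i < k, c i = e

/-- The total weight of a set of edges. -/
def weight (w : β → ℝ) (F : Finset β) : ℝ := ∑ e ∈ F, w e

/-- `T` is a maximum weight forest among the edges in `S`. -/
def IsMaxForest (G : Graph α β) (w : β → ℝ) (S T : Finset β) : Prop :=
  T ⊆ S ∧ IsForest G T ∧ ∀ F ⊆ S, IsForest G F → weight w F ≤ weight w T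

theorem isForest_empty (G : Graph α β) : IsForest G ∅ := fun _ _ _ h =>
  ⟨0, lt_of_lt_of_le Nat.zero_lt_two h.two_le, Finset.notMem_empty _⟩

open Classical in
/-- All the forests with edges in `S`. -/
def forestsIn (G : Graph α β) (S : Finset β) : Finset (Finset β) :=
  S.powerset.filter (IsForest G)

theorem forestsIn_nonempty (G : Graph α β) (S : Finset β) : (forestsIn G S).Nonempty :=
  ⟨∅, by simp [forestsIn, isForest_empty]⟩

/-- Maximum weight forests exist. -/
theorem exists_isMaxForest (G : Graph α β) (w : β → ℝ) (S : Finset β) :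
    ∃ T, IsMaxForest G w S T := by
  obtain ⟨T, hT, hmax⟩ := Finset.exists_max_image _ (weight w) (forestsIn_nonempty G S)
  simp only [forestsIn, Finset.mem_filter, Finset.mem_powerset] at hT hmax
  exact ⟨T, hT.1, hT.2, fun F hF hF' => hmax F ⟨hF, hF'⟩⟩

/-- `OPT`: the maximum weight of an independent set of the graphic matroid of `G`. -/
def opt (G : Graph α β) [Fintype G.edgeSet] (w : β → ℝ) : ℝ :=
  (forestsIn G G.edgeSet.toFinset).sup' (forestsIn_nonempty G _) (weight w)

/-- `a` and `b` lie in the same connected component of the graph formed by the edges in `F`. -/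
def Joined (G : Graph α β) (F : Finset β) (a b : α) : Prop :=
  Relation.ReflTransGen (fun y z => ∃ e ∈ F, G.IsLink e y z) a b

/-- For an edge `e` of a forest `T`, directed towards the vertex `r` with the smallest label in
the component of `T` containing `e`, the vertex `a` is the end that `e` is directed away from:
the other end `b` is still joined to `r` when `e` is removed. Labels are given by the
linear order on vertices. -/
def IsTail [LinearOrder α] [DecidableEq β] (G : Graph α β) (T : Finset β) (e : β) (a : α) : Prop :=
  ∃ b r, G.IsLink e a b ∧ IsLeast {y | Joined G T b y} r ∧ Joined G (T.erase e) b r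

/-- The state of the algorithm: the edges observed so far, the auxiliary set `A*`, the set `A` of
accepted edges, and the edge selected by each vertex, if any. -/
structure State (α : Type u) (β : Type v) where
  observed : Finset β
  candidates : Finset β
  accepted : Finset β
  selected : α → Option β

/-- The initial state. -/
def State.init (α : Type u) (β : Type v) : State α β := ⟨∅, ∅, ∅, fun _ => none⟩

/-- An edge arrives and is only observed. -/
def observe [DecidableEq β] (s : State α β) (e : β) : State α β :=
  { s with observed := insert e s.observed }

open Classical in
/-- An edge `e` arrives and is processed. Here `forest S` is the maximum weight forest that the
algorithm computes when the set of observed edges is `S`, and `coin` is the outcome of the biased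
coin flip of the present time step (used only if `e` closes no cycle in `A*`). -/
def process [LinearOrder α] [DecidableEq β] (G : Graph α β) (forest : Finset β → Finset β)
    (coin : Bool) (s : State α β) (e : β) : State α β :=
  let S := insert e s.observed
  let T := forest S
  if e ∈ T ∧ ∃ a, IsTail G T e a ∧ s.selected a = none then
    { observed := S
      candidates := insert e s.candidates
      accepted :=
        if ClosesCycle G s.candidates e then
          if ClosesCycle G s.accepted e then s.accepted else insert e s.accepted
        else
          if coin then insert e s.accepted else s.accepted
      selected := fun a => if IsTail G T e a then some e else s.selected a }
  else observe s e

/-- The number of edges. -/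
def numEdges (G : Graph α β) [Fintype G.edgeSet] : ℕ := Fintype.card G.edgeSet

/-- The state of the algorithm after the first `t` arrivals, when the edges arrive in the order
`σ 0, σ 1, …, σ (m - 1)` and the coin flips are `coin`. The first `⌊m / e⌋` edges are only
observed. -/
def stateAfter [LinearOrder α] [DecidableEq β] (G : Graph α β) [Fintype G.edgeSet]
    (forest : Finset β → Finset β) (σ : Fin (numEdges G) ≃ G.edgeSet)
    (coin : Fin (numEdges G) → Bool) : ℕ → State α β
  | 0 => State.init α β
  | t + 1 =>
    let s := stateAfter G forest σ coin t
    if h : t < numEdges G then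
      if t < ⌊(numEdges G : ℝ) / Real.exp 1⌋₊ then observe s (σ ⟨t, h⟩)
      else process G forest (coin ⟨t, h⟩) s (σ ⟨t, h⟩)
    else s

/-- The set `A` of accepted edges when all the edges have arrived. -/
def output [LinearOrder α] [DecidableEq β] (G : Graph α β) [Fintype G.edgeSet]
    (forest : Finset β → Finset β) (σ : Fin (numEdges G) ≃ G.edgeSet)
    (coin : Fin (numEdges G) → Bool) : Finset β :=
  (stateAfter G forest σ coin (numEdges G)).accepted

/-- The expected gain of the algorithm: the arrival order is uniform among all `m!` orders of the
edges, and independently of it the coin flips are independent and succeed with probability `ρ`. -/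
def expectedGain [LinearOrder α] [DecidableEq β] (G : Graph α β) [Fintype G.edgeSet]
    (w : β → ℝ) (forest : Finset β → Finset β) (ρ : ℝ) : ℝ :=
  (∑ σ : Fin (numEdges G) ≃ G.edgeSet, ∑ coin : Fin (numEdges G) → Bool,
    (∏ i, if coin i then ρ else 1 - ρ) * weight w (output G forest σ coin)) /
      (Nat.factorial (numEdges G) : ℝ)

/-- The roots in `[0, 1]` of the polynomial `1 - x - x ^ (g - 1)`. -/
def rootSet (g : ℕ) : Set ℝ := {x | 0 ≤ x ∧ x ≤ 1 ∧ 1 - x - x ^ (g - 1) = 0}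

/-- The number `x_g`, that is, the only element of `rootSet g` when `2 ≤ g`. -/
def xRoot (g : ℕ) : ℝ := sSup (rootSet g)

/-- The algorithm with parameter `g` (and acceptance probability `x_g`) is a valid `c`-competitive
algorithm for the graphic matroid secretary problem on the finite loopless weighted multigraphs of
girth at least `g`, whatever rule `forest` it uses to choose a maximum weight forest (that
is, to break ties) as a function of the set of observed edges: the accepted edges form an
independent set at all times, and `OPT ≤ c * E(ALG)`. -/
def IsCompetitive (g : ℕ) (c : ℝ) : Prop :=
  1 ≤ c ∧
  ∀ (α : Type u) (β : Type v) [LinearOrder α] [DecidableEq β] (G : Graph α β) [G.Loopless]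
    [Fintype G.edgeSet] (w : β → ℝ) (forest : Finset β → Finset β),
    GirthAtLeast G g →
    (∀ S : Finset β, (S : Set β) ⊆ G.edgeSet → IsMaxForest G w S (forest S)) →
    (∀ (σ : Fin (numEdges G) ≃ G.edgeSet) (coin : Fin (numEdges G) → Bool) (t : ℕ),
      IsForest G (stateAfter G forest σ coin t).accepted) ∧
    opt G w ≤ c * expectedGain G w forest (xRoot g)

end GraphicSecretary

end

/-!
Fix the order of the edges. The candidate set `A*` does not depend on the coins, and in `A*` every
vertex has selected at most one edge, so that the edges of `A*` have distinct selecting ends. Hence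
every component of `A*` contains at most one cycle (`cycle_edges_subset`). If a candidate `e` closes
a cycle `C` in `A*`, then no other edge of `C` closed a cycle on arrival, so each of them was
accepted by its own coin, and `e` is rejected only if all these coins showed success
(`coin_of_not_mem_accepted`). This has probability at most `x_g ^ (g - 1) = 1 - x_g`. So every
candidate is accepted with probability at least `x_g` (`le_sum_coinProb_accepted`).

The expected weight of `A*` is at least `OPT / e`. The edge arriving at time `t` is a uniformly
random one of the edges seen so far, so its expected weight, counted if it lies in the current
maximum weight forest, is at least `OPT / m` (`factorial_mul_opt_le`). Its tail `u` depends only on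
the last edge and the set of the earlier ones. Going backwards in time, each earlier edge is uniform
among the edges up to it, and at most one of them leaves `u` in the forest of that time, by
`IsTail.edge_unique`. So `u` is still free with probability at least
`∏ (1 - 1 / (r + 1)) = ⌊m / e⌋ / t` (`mul_sum_le_mul_sum_of_harm`). Summing over `t` gives the
success probability of the classical secretary rule, which is at least `1 / e` for every `m`
(`div_exp_le_secretary_sum`).

The function `1 - x - x ^ (g - 1)` is strictly decreasing on `[0, 1]`, so the bounds on `x_g` follow
from its sign at the bounds.
-/

namespace GraphicSecretary

variable {α : Type u} {β : Type v}

/-! ### Connectivity and cycles -/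

theorem Joined.mono {G : Graph α β} {F F' : Finset β} (h : F ⊆ F') {a b : α}
    (hab : Joined G F a b) : Joined G F' a b :=
  Relation.ReflTransGen.mono (fun _ _ ⟨e, he, hl⟩ => ⟨e, h he, hl⟩) _ _ hab

theorem Joined.symm {G : Graph α β} {F : Finset β} {a b : α} (h : Joined G F a b) :
    Joined G F b a := by
  induction h with
  | refl => exact Relation.ReflTransGen.refl
  | tail _ h ih =>
    obtain ⟨e, he, hl⟩ := h
    exact Relation.ReflTransGen.head ⟨e, he, hl.symm⟩ ih

theorem Joined.trans {G : Graph α β} {F : Finset β} {a b c : α} (h : Joined G F a b)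
    (h' : Joined G F b c) : Joined G F a c :=
  Relation.ReflTransGen.trans h h'

theorem joined_of_isLink {G : Graph α β} {F : Finset β} {e : β} {a b : α} (he : e ∈ F)
    (h : G.IsLink e a b) : Joined G F a b :=
  Relation.ReflTransGen.single ⟨e, he, h⟩

/-- `x 0, …, x n` is a walk from `a` to `b` along the edges `c 0, …, c (n - 1)` of `F`. -/
def IsWalk (G : Graph α β) (F : Finset β) (a b : α) (n : ℕ) (x : ℕ → α) (c : ℕ → β) : Prop :=
  x 0 = a ∧ x n = b ∧ ∀ i < n, c i ∈ F ∧ G.IsLink (c i) (x i) (x (i + 1))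

theorem Joined.exists_isWalk [Nonempty β] {G : Graph α β} {F : Finset β} {a b : α}
    (h : Joined G F a b) : ∃ n x c, IsWalk G F a b n x c := by
  classical
  induction h with
  | refl => exact ⟨0, fun _ => a, fun _ => Classical.arbitrary β, rfl, rfl, by simp⟩
  | @tail y z _ h ih =>
    obtain ⟨n, x, c, h0, hn, hw⟩ := ih
    obtain ⟨e, he, hl⟩ := h
    refine ⟨n + 1, fun i => if i ≤ n then x i else z, fun i => if i < n then c i else e,
      by simpa using h0, by simp, fun i hi => ?_⟩
    rcases Nat.lt_succ_iff_lt_or_eq.1 hi with hi' | rfl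
    · have : i + 1 ≤ n := hi'
      simpa [hi', hi'.le, this] using hw i hi'
    · simpa [hn] using ⟨he, hl⟩

/-- A shortest walk visits no vertex twice: otherwise the part between two visits could be cut
out. -/
theorem Joined.exists_isWalk_injOn [Nonempty β] {G : Graph α β} {F : Finset β} {a b : α}
    (h : Joined G F a b) :
    ∃ n x c, IsWalk G F a b n x c ∧ Set.InjOn x (Set.Iic n) := by
  classical
  have hex : ∃ n, ∃ x c, IsWalk G F a b n x c := h.exists_isWalk
  obtain ⟨x, c, hw⟩ := Nat.find_spec hex
  set n := Nat.find hex
  refine ⟨n, x, c, hw, ?_⟩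
  have key : ∀ i j, i < j → j ≤ n → x i ≠ x j := by
    intro i j hij hjn hx
    obtain ⟨h0, h1, h2⟩ := hw
    refine Nat.find_min hex (m := n - (j - i)) (by omega)
      ⟨fun l => if l ≤ i then x l else x (l + (j - i)),
        fun l => if l < i then c l else c (l + (j - i)), by simpa using h0, ?_, fun l hl => ?_⟩
    · show (if n - (j - i) ≤ i then _ else _) = b
      split_ifs with hc
      · have e1 : n - (j - i) = i := by omega
        have e2 : n = j := by omega
        rw [e1, hx, ← e2, h1]
      · rw [show n - (j - i) + (j - i) = n by omega, h1]
    · by_cases hli : l < i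
      · have : l + 1 ≤ i := hli
        simpa [hli, hli.le, this] using h2 l (by omega)
      · have hli' : ¬ l + 1 ≤ i := by omega
        have := h2 (l + (j - i)) (by omega)
        rw [show l + (j - i) + 1 = l + 1 + (j - i) by omega] at this
        by_cases hle : l ≤ i
        · have e1 : l = i := by omega
          subst e1
          rw [show l + (j - l) = j by omega, ← hx] at this
          have e3 : l + (j - l) = j := by omega
          simpa [e3] using this
        · simpa [hli, hli', hle] using this
  intro i hi j hj hx
  rcases lt_trichotomy i j with h | h | h
  · exact absurd hx (key i j h hj)
  · exact h
  · exact absurd hx.symm (key j i h hi)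

/-- Ends joined by a path that avoids the edge `e` make a cycle with `e`. -/
theorem exists_isCycle_of_joined {G : Graph α β} {F : Finset β} {e : β} {a b : α}
    (hab : a ≠ b) (he : G.IsLink e a b) (heF : e ∉ F) (h : Joined G F a b) :
    ∃ k x c, IsCycle G k x c ∧ ∀ i < k, c i = e ∨ c i ∈ F := by
  classical
  have : Nonempty β := ⟨e⟩
  obtain ⟨n, x, c, ⟨h0, hn, hw⟩, hinj⟩ := h.exists_isWalk_injOn
  have hn0 : n ≠ 0 := by
    rintro rfl
    exact hab (h0.symm.trans hn)
  have hcinj : ∀ i j, i < j → j < n → c i ≠ c j := by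
    intro i j hij hj hc
    have h1 := (hw i (by omega)).2
    rw [hc] at h1
    rcases h1.eq_and_eq_or_eq_and_eq (hw j hj).2 with ⟨h2, -⟩ | ⟨h2, -⟩
    · have := hinj (show i ≤ n by omega) (show j ≤ n by omega) h2
      omega
    · have := hinj (show i ≤ n by omega) (show j + 1 ≤ n by omega) h2
      omega
  refine ⟨n + 1, fun i => if i ≤ n then x i else a, fun i => if i < n then c i else e,
    ⟨by omega, by simp [h0], fun i hi => ?_, fun i hi j hj hij => ?_, fun i hi j hj hij => ?_⟩,
    fun i hi => ?_⟩
  · rcases Nat.lt_succ_iff_lt_or_eq.1 hi with hi' | rfl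
    · have : i + 1 ≤ n := hi'
      simpa [hi', hi'.le, this] using (hw i hi').2
    · simpa [hn] using he.symm
  · have hi' : i ≤ n := Nat.lt_succ_iff.1 hi
    have hj' : j ≤ n := Nat.lt_succ_iff.1 hj
    simp only [hi', hj', if_true] at hij
    exact hinj hi' hj' hij
  · have hi' : i ≤ n := Nat.lt_succ_iff.1 hi
    have hj' : j ≤ n := Nat.lt_succ_iff.1 hj
    rcases hi'.lt_or_eq with h1 | h1 <;> rcases hj'.lt_or_eq with h2 | h2
    · simp only [h1, h2, if_true] at hij
      rcases lt_trichotomy i j with h | h | h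
      · exact absurd hij (hcinj i j h h2)
      · exact h
      · exact absurd hij.symm (hcinj j i h h1)
    · subst h2
      simp only [h1, if_true, lt_irrefl, if_false] at hij
      exact absurd (hij ▸ (hw i h1).1) heF
    · subst h1
      simp only [h2, if_true, lt_irrefl, if_false] at hij
      exact absurd (hij ▸ (hw j h2).1) heF
    · exact h1.trans h2.symm
  · by_cases h1 : i < n
    · simpa [h1] using Or.inr (hw i h1).1
    · simp [h1]

/-- Every edge of a forest is a bridge. -/
theorem IsForest.not_joined_erase [DecidableEq β] {G : Graph α β} [G.Loopless] {T : Finset β}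
    (hT : IsForest G T) {e : β} (heT : e ∈ T) {a b : α} (he : G.IsLink e a b) :
    ¬ Joined G (T.erase e) a b := by
  intro h
  obtain ⟨k, x, c, hC, hc⟩ := exists_isCycle_of_joined he.ne he (Finset.notMem_erase e T) h
  obtain ⟨i, hi, hci⟩ := hT k x c hC
  rcases hc i hi with h1 | h1
  · exact hci (h1 ▸ heT)
  · exact hci (Finset.mem_of_mem_erase h1)

theorem IsForest.insert [DecidableEq β] {G : Graph α β} {F : Finset β} (hF : IsForest G F)
    {e : β} (he : ¬ ClosesCycle G F e) : IsForest G (insert e F) := by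
  intro k x c hC
  by_contra! hcon
  by_cases h : ∃ i < k, c i = e
  · exact he ⟨k, x, c, hC, fun i hi => by simpa using hcon i hi, h⟩
  · push Not at h
    obtain ⟨i, hi, hci⟩ := hF k x c hC
    rcases Finset.mem_insert.1 (hcon i hi) with h1 | h1
    · exact h i hi h1
    · exact hci h1

theorem ClosesCycle.mono {G : Graph α β} {F F' : Finset β} (h : F ⊆ F') {e : β}
    (he : ClosesCycle G F e) : ClosesCycle G F' e := by
  obtain ⟨k, x, c, hC, hc, h1⟩ := he
  exact ⟨k, x, c, hC, fun i hi => (hc i hi).imp_right (@h _), h1⟩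

/-! ### Edges of a forest directed towards the root of their component -/

/-- Look at the part of the path after its last use of the edge `e = ab`. -/
theorem Joined.erase_cases [DecidableEq β] {G : Graph α β} {F : Finset β} {e : β} {a b y r : α}
    (he : G.IsLink e a b) (h : Joined G F y r) :
    Joined G (F.erase e) y r ∨ Joined G (F.erase e) a r ∨ Joined G (F.erase e) b r := by
  induction h using Relation.ReflTransGen.head_induction_on with
  | refl => exact Or.inl Relation.ReflTransGen.refl
  | @head y z h _ ih =>
    obtain ⟨f, hf, hl⟩ := h
    rcases ih with ih | ih
    · by_cases hfe : f = e
      · subst hfe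
        rcases hl.eq_and_eq_or_eq_and_eq he with ⟨-, rfl⟩ | ⟨-, rfl⟩
        · exact Or.inr (Or.inr ih)
        · exact Or.inr (Or.inl ih)
      · exact Or.inl (Joined.trans (joined_of_isLink (Finset.mem_erase.2 ⟨hfe, hf⟩) hl) ih)
    · exact Or.inr ih

theorem finite_joined (G : Graph α β) (F : Finset β) (a : α) : {y | Joined G F a y}.Finite := by
  have hfin : ∀ e : β, {y | G.Inc e y}.Finite := by
    intro e
    by_cases h : ∃ y z, G.IsLink e y z
    · obtain ⟨y, z, hl⟩ := h
      refine (Set.toFinite {y, z}).subset fun w hw => ?_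
      exact Graph.Inc.eq_or_eq_of_isLink hw hl
    · refine Set.finite_empty.subset fun w hw => ?_
      obtain ⟨z, hz⟩ := hw
      exact h ⟨w, z, hz⟩
  refine ((Set.finite_singleton a).union (F.finite_toSet.biUnion fun e _ => hfin e)).subset ?_
  intro y hy
  rcases Relation.ReflTransGen.cases_tail hy with h | ⟨z, -, e, he, hl⟩
  · exact Or.inl h
  · exact Or.inr (Set.mem_biUnion he hl.inc_right)

theorem exists_isLeast_joined [LinearOrder α] (G : Graph α β) (F : Finset β) (a : α) :
    ∃ r, IsLeast {y | Joined G F a y} r := by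
  obtain ⟨r, hr, hmin⟩ := Set.exists_min_image _ id (finite_joined G F a)
    ⟨a, Relation.ReflTransGen.refl⟩
  exact ⟨r, hr, fun y hy => hmin y hy⟩

theorem joined_set_eq {G : Graph α β} {F : Finset β} {a b : α} (h : Joined G F a b) :
    {y | Joined G F a y} = {y | Joined G F b y} :=
  Set.ext fun _ => ⟨fun hy => h.symm.trans hy, fun hy => h.trans hy⟩

section Tail

variable [LinearOrder α] [DecidableEq β] {G : Graph α β} {T : Finset β} {e e' : β} {a a' : α}

theorem IsTail.inc (h : IsTail G T e a) : G.Inc e a := by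
  obtain ⟨b, r, hl, -⟩ := h
  exact hl.inc_left

theorem exists_isTail (heT : e ∈ T) (he : e ∈ G.edgeSet) : ∃ a, IsTail G T e a := by
  obtain ⟨a, b, hl⟩ := G.exists_isLink_of_mem_edgeSet he
  obtain ⟨r, hr⟩ := exists_isLeast_joined G T b
  have hrb : Joined G T b r := hr.1
  have hb : Joined G (T.erase e) b r → ∃ a, IsTail G T e a := fun h => ⟨a, b, r, hl, hr, h⟩
  rcases hrb.erase_cases hl with h | h | h
  · exact hb h
  · refine ⟨b, a, r, hl.symm, ?_, h⟩
    rwa [joined_set_eq (joined_of_isLink heT hl)]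
  · exact hb h

theorem IsTail.unique [G.Loopless] (hT : IsForest G T) (heT : e ∈ T) (h : IsTail G T e a)
    (h' : IsTail G T e a') : a = a' := by
  obtain ⟨b, r, hl, hr, hj⟩ := h
  obtain ⟨b', r', hl', hr', hj'⟩ := h'
  rcases hl.eq_and_eq_or_eq_and_eq hl' with ⟨h1, -⟩ | ⟨rfl, rfl⟩
  · exact h1
  · rw [joined_set_eq (joined_of_isLink heT hl)] at hr'
    rw [hr'.unique hr] at hj'
    exact absurd (hj'.trans hj.symm) (hT.not_joined_erase heT hl)

/-- In a forest directed towards its roots, every vertex has at most one outgoing edge. -/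
theorem IsTail.edge_unique [G.Loopless] (hT : IsForest G T) (heT : e ∈ T) (heT' : e' ∈ T)
    (h : IsTail G T e a) (h' : IsTail G T e' a) : e = e' := by
  by_contra hne
  obtain ⟨b, r, hl, hr, hj⟩ := h
  obtain ⟨b', r', hl', hr', hj'⟩ := h'
  rw [← joined_set_eq (joined_of_isLink heT' hl'),
    joined_set_eq (joined_of_isLink heT hl)] at hr'
  rw [hr'.unique hr] at hj'
  have n := hT.not_joined_erase heT hl
  have n' := hT.not_joined_erase heT' hl'
  have hsub : (T.erase e').erase e ⊆ T.erase e :=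
    Finset.erase_subset_erase _ (Finset.erase_subset _ _)
  have hab' : Joined G (T.erase e) a b' :=
    joined_of_isLink (Finset.mem_erase.2 ⟨Ne.symm hne, heT'⟩) hl'
  rcases hj'.symm.erase_cases hl with h1 | h1 | h1
  · exact n ((hab'.trans (h1.mono hsub).symm).trans hj.symm)
  · exact n' (h1.mono (Finset.erase_subset _ _))
  · exact n (hab'.trans (h1.mono hsub).symm)

end Tail

/-! ### Cycles when every vertex selects at most one edge -/

/-- If `F` has an injective choice of an end of each edge, then two cycles in `F` with a common edge
have the same edges. On a cycle there are as many vertices as edges, so each vertex of the cycle is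
the chosen end of an edge of the cycle. The common edges of the two cycles are therefore at least as
many as the common vertices, and this forces the set of common vertices to be closed under moving
forward along the first cycle. -/
theorem cycle_edges_subset {G : Graph α β} {F : Finset β} {tail : β → α}
    (hinc : ∀ e ∈ F, G.Inc e (tail e)) (hinj : Set.InjOn tail F)
    {k k' : ℕ} {x x' : ℕ → α} {c c' : ℕ → β} (hC : IsCycle G k x c) (hC' : IsCycle G k' x' c')
    (hF : ∀ i < k, c i ∈ F) (hF' : ∀ i < k', c' i ∈ F)
    (hshare : ∃ i < k, ∃ j < k', c i = c' j) :
    ∀ i < k, ∃ j < k', c i = c' j := by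
  classical
  have surj : ∀ {k : ℕ} {x : ℕ → α} {c : ℕ → β}, IsCycle G k x c → (∀ i < k, c i ∈ F) →
      ∀ i < k, ∃ j < k, tail (c j) = x i := by
    intro k x c hC hF i hi
    have hk : 2 ≤ k := hC.two_le
    have hsub : (Finset.range k).image (fun j => tail (c j)) ⊆ (Finset.range k).image x := by
      intro y hy
      obtain ⟨j, hj, rfl⟩ := Finset.mem_image.1 hy
      have hj := Finset.mem_range.1 hj
      rcases (hinc _ (hF j hj)).eq_or_eq_of_isLink (hC.isLink j hj) with h | h
      · exact Finset.mem_image.2 ⟨j, Finset.mem_range.2 hj, h.symm⟩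
      · rcases (Nat.succ_le_of_lt hj).lt_or_eq with h1 | h1
        · exact Finset.mem_image.2 ⟨j + 1, Finset.mem_range.2 h1, h.symm⟩
        · refine Finset.mem_image.2 ⟨0, Finset.mem_range.2 (by omega), ?_⟩
          rw [← hC.closed, h, ← h1]
    have hcard : ((Finset.range k).image x).card ≤
        ((Finset.range k).image (fun j => tail (c j))).card := by
      rw [Finset.card_image_of_injOn, Finset.card_image_of_injOn]
      · intro i hi j hj hij
        have hi := Finset.mem_range.1 hi
        have hj := Finset.mem_range.1 hj
        exact hC.edge_inj hi hj (hinj (hF i hi) (hF j hj) hij)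
      · simpa [Set.InjOn] using hC.vertex_inj
    have := Finset.eq_of_subset_of_card_le hsub hcard
    have hmem : x i ∈ (Finset.range k).image x :=
      Finset.mem_image_of_mem _ (Finset.mem_range.2 hi)
    rw [← this] at hmem
    obtain ⟨j, hj, h⟩ := Finset.mem_image.1 hmem
    exact ⟨j, Finset.mem_range.1 hj, h⟩
  set I := (Finset.range k).filter fun i => ∃ j < k', x i = x' j with hI
  set J := (Finset.range k).filter fun i => ∃ j < k', c i = c' j with hJ
  -- the ends of an edge of the second cycle lie on that cycle
  have ends : ∀ {e : β} {y z : α}, G.IsLink e y z → (∃ j < k', e = c' j) → ∃ j < k', y = x' j := by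
    rintro e y z hl ⟨j, hj, rfl⟩
    rcases hl.left_eq_or_eq (hC'.isLink j hj) with h | h
    · exact ⟨j, hj, h⟩
    · rcases (Nat.succ_le_of_lt hj).lt_or_eq with h1 | h1
      · exact ⟨j + 1, h1, h⟩
      · exact ⟨0, by have := hC'.two_le; omega, by rw [← hC'.closed, h, ← h1]⟩
  have hJI : J ⊆ I := by
    intro i hi
    obtain ⟨hi, h⟩ := Finset.mem_filter.1 hi
    exact Finset.mem_filter.2 ⟨hi, ends (hC.isLink i (Finset.mem_range.1 hi)) h⟩
  have hIJ : I.card ≤ J.card := by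
    have hIx : (I.image x).card = I.card := by
      refine Finset.card_image_of_injOn fun i hi j hj hij => hC.vertex_inj ?_ ?_ hij
      · exact Finset.mem_range.1 (Finset.mem_filter.1 hi).1
      · exact Finset.mem_range.1 (Finset.mem_filter.1 hj).1
    rw [← hIx]
    refine (Finset.card_le_card (t := J.image fun i => tail (c i)) ?_).trans Finset.card_image_le
    intro y hy
    obtain ⟨i, hi, rfl⟩ := Finset.mem_image.1 hy
    obtain ⟨hi, j, hj, hij⟩ := Finset.mem_filter.1 hi
    have hi := Finset.mem_range.1 hi
    obtain ⟨p, hp, hpx⟩ := surj hC hF i hi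
    obtain ⟨q, hq, hqx⟩ := surj hC' hF' j hj
    refine Finset.mem_image.2 ⟨p, Finset.mem_filter.2 ⟨Finset.mem_range.2 hp, q, hq, ?_⟩, hpx⟩
    exact hinj (hF p hp) (hF' q hq) (by rw [hpx, hqx, hij])
  have hEq : J = I := Finset.eq_of_subset_of_card_le hJI hIJ
  have step : ∀ i < k, (∃ j < k', x i = x' j) → ∃ j < k', c i = c' j := by
    intro i hi h
    have : i ∈ J := hEq ▸ Finset.mem_filter.2 ⟨Finset.mem_range.2 hi, h⟩
    exact (Finset.mem_filter.1 this).2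
  have next : ∀ i < k, (∃ j < k', x i = x' j) → ∃ j < k', x (i + 1) = x' j :=
    fun i hi h => ends (hC.isLink i hi).symm (step i hi h)
  obtain ⟨i₀, hi₀, h₀⟩ := hshare
  have h1 : ∀ d, i₀ + d ≤ k → ∃ j < k', x (i₀ + d) = x' j := by
    intro d
    induction d with
    | zero => intro _; exact ends (hC.isLink i₀ hi₀) h₀
    | succ d ih => intro hd; exact next (i₀ + d) (by omega) (ih (by omega))
  have h2 : ∃ j < k', x 0 = x' j := by
    have := h1 (k - i₀) (by omega)
    rwa [show i₀ + (k - i₀) = k by omega, hC.closed] at this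
  have h3 : ∀ d, d ≤ k → ∃ j < k', x d = x' j := by
    intro d
    induction d with
    | zero => exact fun _ => h2
    | succ d ih => intro hd; exact next _ (by omega) (ih (by omega))
  exact fun i hi => step i hi (h3 i hi.le)

/-! ### Independent coin flips -/

/-- The probability of a sequence of coin flips with success probability `ρ`. -/
def coinProb {ι : Type*} [Fintype ι] (ρ : ℝ) (coin : ι → Bool) : ℝ :=
  ∏ i, if coin i then ρ else 1 - ρ

theorem coinProb_nonneg {ι : Type*} [Fintype ι] {ρ : ℝ} (h0 : 0 ≤ ρ) (h1 : ρ ≤ 1)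
    (coin : ι → Bool) : 0 ≤ coinProb ρ coin :=
  Finset.prod_nonneg fun i _ => by split_ifs <;> linarith

theorem sum_coinProb_forall_mem {ι : Type*} [Fintype ι] [DecidableEq ι] (ρ : ℝ) (I : Finset ι)
    [∀ coin : ι → Bool, Decidable (∀ i ∈ I, coin i = true)] :
    ∑ coin : ι → Bool, coinProb ρ coin * (if ∀ i ∈ I, coin i = true then 1 else 0) =
      ρ ^ I.card := by
  let f : ι → Bool → ℝ := fun i b => if b then ρ else if i ∈ I then 0 else 1 - ρ
  have h : ∀ coin : ι → Bool,
      coinProb ρ coin * (if ∀ i ∈ I, coin i = true then 1 else 0) = ∏ i, f i (coin i) := by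
    intro coin
    split_ifs with hc
    · rw [mul_one]
      refine Finset.prod_congr rfl fun i _ => ?_
      by_cases hi : i ∈ I
      · simp [f, hc i hi]
      · simp [f, hi]
    · push Not at hc
      obtain ⟨i, hi, hci⟩ := hc
      rw [mul_zero, eq_comm]
      exact Finset.prod_eq_zero (Finset.mem_univ i) (by simp [f, hi, hci])
  rw [Finset.sum_congr rfl fun coin _ => h coin, ← Fintype.prod_sum f]
  have h2 : ∀ i, ∑ b, f i b = if i ∈ I then ρ else 1 := by
    intro i
    by_cases hi : i ∈ I <;> simp [f, hi]
  rw [Finset.prod_congr rfl fun i _ => h2 i, Finset.prod_ite_mem, Finset.univ_inter,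
    Finset.prod_const]

theorem sum_coinProb {ι : Type*} [Fintype ι] [DecidableEq ι] (ρ : ℝ) :
    ∑ coin : ι → Bool, coinProb ρ coin = 1 := by
  simpa using sum_coinProb_forall_mem (ι := ι) ρ ∅

/-! ### Uniformly random orders -/

section Orders

variable {m : ℕ} {E : Type*} [Fintype E] [DecidableEq E]

theorem sum_order_trans (π : Equiv.Perm (Fin m)) (f : (Fin m ≃ E) → ℝ) :
    ∑ σ, f (π.trans σ) = ∑ σ, f σ :=
  Equiv.sum_comp (Equiv.equivCongr π.symm (Equiv.refl E)) f

/-- Each element is equally likely to be at each position of the order. -/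
theorem card_mul_sum_order_apply (f : E → ℝ) (hm : Fintype.card E = m) (i : Fin m) :
    (m : ℝ) * ∑ σ : Fin m ≃ E, f (σ i) = (m.factorial : ℝ) * ∑ e, f e := by
  have h : ∀ j : Fin m, ∑ σ : Fin m ≃ E, f (σ j) = ∑ σ : Fin m ≃ E, f (σ i) := by
    intro j
    rw [← sum_order_trans (Equiv.swap i j)]
    simp
  have h2 : ∑ j : Fin m, ∑ σ : Fin m ≃ E, f (σ j) = (m : ℝ) * ∑ σ : Fin m ≃ E, f (σ i) := by
    rw [Finset.sum_congr rfl fun j _ => h j]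
    simp
  rw [← h2, Finset.sum_comm]
  have h3 : ∀ σ : Fin m ≃ E, ∑ j, f (σ j) = ∑ e, f e := fun σ => Equiv.sum_comp σ f
  have hcard : Fintype.card (Fin m ≃ E) = m.factorial := by
    rw [Fintype.card_equiv (Fintype.equivFinOfCardEq hm).symm, Fintype.card_fin]
  simp [h3, hcard]

/-- **Survival of a vertex.** Think of `D r σ` as the event that position `r` of the order `σ` does
harm. If `D r` does not depend on the relative order of the earlier positions, and if at most one
of the first `r + 1` elements can do harm when put at position `r`, then the probability that none
of the positions `q, …, s - 1` does harm is at least `∏ r, (1 - 1 / (r + 1)) = q / s`. This holds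
relative to any weight `Ψ` that does not depend on the relative order of the first `s` positions. -/
theorem mul_sum_le_mul_sum_of_harm (D : Fin m → (Fin m ≃ E) → Prop)
    [∀ r σ, Decidable (D r σ)] {q s : ℕ} (hqs : q ≤ s)
    (hsm : s ≤ m)
    (hinv : ∀ r : Fin m, (r : ℕ) < s → ∀ π : Equiv.Perm (Fin m), (∀ i, r ≤ i → π i = i) →
      ∀ σ, D r (π.trans σ) ↔ D r σ)
    (hone : ∀ r : Fin m, (r : ℕ) < s → ∀ σ,
      ((Finset.Iic r).filter fun i => D r ((Equiv.swap i r).trans σ)).card ≤ 1)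
    (Ψ : (Fin m ≃ E) → ℝ) (h0 : ∀ σ, 0 ≤ Ψ σ)
    (hΨ : ∀ π : Equiv.Perm (Fin m), (∀ i : Fin m, s ≤ (i : ℕ) → π i = i) →
      ∀ σ, Ψ (π.trans σ) = Ψ σ) :
    (q : ℝ) * ∑ σ, Ψ σ ≤
      s * ∑ σ, Ψ σ * (if ∀ r : Fin m, q ≤ (r : ℕ) → (r : ℕ) < s → ¬ D r σ then 1 else 0) := by
  induction s, hqs using Nat.le_induction generalizing Ψ with
  | base =>
    have : ∀ σ, (∀ r : Fin m, q ≤ (r : ℕ) → (r : ℕ) < q → ¬ D r σ) :=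
      fun σ r h1 h2 => absurd h1 (by omega)
    refine le_of_eq (congrArg _ (Finset.sum_congr rfl fun σ _ => ?_))
    rw [if_pos (this σ), mul_one]
  | succ s hqs ih =>
    set R : Fin m := ⟨s, hsm⟩ with hR
    set Ψ' : (Fin m ≃ E) → ℝ := fun σ => Ψ σ * (if D R σ then 0 else 1) with hΨ'
    have hΨ'0 : ∀ σ, 0 ≤ Ψ' σ := fun σ => mul_nonneg (h0 σ) (by split_ifs <;> norm_num)
    have hih := ih (by omega) (fun r hr => hinv r (by omega)) (fun r hr => hone r (by omega)) Ψ'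
      hΨ'0 (fun π hπ σ => by
        simp only [hΨ']
        rw [hΨ π (fun i hi => hπ i (by omega)) σ]
        simp only [hinv R (by simp [hR]) π (fun i hi => hπ i hi) σ])
    have hterm : ∀ σ, Ψ' σ * (if ∀ r : Fin m, q ≤ (r : ℕ) → (r : ℕ) < s → ¬ D r σ then 1 else 0) =
        Ψ σ * (if ∀ r : Fin m, q ≤ (r : ℕ) → (r : ℕ) < s + 1 → ¬ D r σ then 1 else 0) := by
      intro σ
      simp only [hΨ', mul_assoc]
      congr 1
      have hiff : (∀ r : Fin m, q ≤ (r : ℕ) → (r : ℕ) < s + 1 → ¬ D r σ) ↔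
          ¬ D R σ ∧ ∀ r : Fin m, q ≤ (r : ℕ) → (r : ℕ) < s → ¬ D r σ := by
        refine ⟨fun h => ⟨h R hqs (by simp [hR]), fun r h1 h2 => h r h1 (by omega)⟩, ?_⟩
        rintro ⟨h1, h2⟩ r h3 h4
        rcases Nat.lt_succ_iff_lt_or_eq.1 h4 with h5 | h5
        · exact h2 r h3 h5
        · rwa [show r = R from Fin.ext h5]
      simp only [hiff]
      by_cases h : D R σ <;> simp [h]
    rw [Finset.sum_congr rfl fun σ _ => hterm σ] at hih
    have hstep : (s : ℝ) * ∑ σ, Ψ σ ≤ (s + 1) * ∑ σ, Ψ' σ := by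
      have h1 : ((s : ℝ) + 1) * ∑ σ, Ψ' σ =
          ∑ i ∈ Finset.Iic R, ∑ σ, Ψ' ((Equiv.swap i R).trans σ) := by
        simp only [sum_order_trans]
        rw [Finset.sum_const, Fin.card_Iic]
        simp [hR]
      rw [h1, Finset.sum_comm, Finset.mul_sum]
      refine Finset.sum_le_sum fun σ _ => ?_
      have h2 : ∀ i ∈ Finset.Iic R, Ψ' ((Equiv.swap i R).trans σ) =
          Ψ σ * (if D R ((Equiv.swap i R).trans σ) then 0 else 1) := by
        intro i hi
        simp only [hΨ']
        congr 1
        refine hΨ _ (fun j hj => Equiv.swap_apply_of_ne_of_ne ?_ ?_) σ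
        · rintro rfl
          have := Fin.le_def.1 (Finset.mem_Iic.1 hi)
          simp only [hR] at this
          omega
        · rintro rfl
          simp [hR] at hj
      rw [Finset.sum_congr rfl h2, ← Finset.mul_sum, mul_comm]
      refine mul_le_mul_of_nonneg_left ?_ (h0 σ)
      have h3 : ∀ i, (if D R ((Equiv.swap i R).trans σ) then (0 : ℝ) else 1) =
          1 - if D R ((Equiv.swap i R).trans σ) then 1 else 0 := fun i => by split_ifs <;> simp
      rw [Finset.sum_congr rfl fun i _ => h3 i, Finset.sum_sub_distrib, Finset.sum_boole]
      have h4 : (((Finset.Iic R).filter fun i => D R ((Equiv.swap i R).trans σ)).card : ℝ) ≤ 1 := by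
        exact_mod_cast hone R (by simp [hR]) σ
      have h5 : ∑ i ∈ Finset.Iic R, (1 : ℝ) = s + 1 := by
        rw [Finset.sum_const, Fin.card_Iic]
        simp [hR]
      rw [h5]
      linarith
    have hP : 0 ≤ ∑ σ, Ψ σ *
        (if ∀ r : Fin m, q ≤ (r : ℕ) → (r : ℕ) < s + 1 → ¬ D r σ then (1 : ℝ) else 0) :=
      Finset.sum_nonneg fun σ _ => mul_nonneg (h0 σ) (by split_ifs <;> norm_num)
    push_cast
    rcases Nat.eq_zero_or_pos s with hs | hs
    · have : q = 0 := by omega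
      simp only [this, Nat.cast_zero, zero_mul]
      subst this
      positivity
    · have hs' : (0 : ℝ) < s := by exact_mod_cast hs
      refine le_of_mul_le_mul_left ?_ hs'
      calc (s : ℝ) * (q * ∑ σ, Ψ σ) = q * (s * ∑ σ, Ψ σ) := by ring
        _ ≤ q * ((s + 1) * ∑ σ, Ψ' σ) := by gcongr
        _ = (s + 1) * (q * ∑ σ, Ψ' σ) := by ring
        _ ≤ (s + 1) * (s * _) := mul_le_mul_of_nonneg_left hih (by positivity)
        _ = _ := by ring

end Orders

/-! ### The run of the algorithm on a fixed order -/

/-- The length of the initial phase in which edges are only observed. -/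
noncomputable def sampleSize (G : Graph α β) [Fintype G.edgeSet] : ℕ :=
  ⌊(numEdges G : ℝ) / Real.exp 1⌋₊

/-- The set of the first `t` edges in the order `σ`. -/
def seen [DecidableEq β] {G : Graph α β} [Fintype G.edgeSet]
    (σ : Fin (numEdges G) ≃ G.edgeSet) (t : ℕ) : Finset β :=
  (Finset.univ.filter fun i : Fin (numEdges G) => (i : ℕ) < t).image fun i => (σ i : β)

section Seen

variable [DecidableEq β] {G : Graph α β} [Fintype G.edgeSet]
  {σ : Fin (numEdges G) ≃ G.edgeSet}

theorem seen_subset (t : ℕ) : (seen σ t : Set β) ⊆ G.edgeSet := by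
  intro e he
  obtain ⟨i, -, rfl⟩ := Finset.mem_image.1 (Finset.mem_coe.1 he)
  exact (σ i).2

theorem seen_succ (t : Fin (numEdges G)) :
    seen σ ((t : ℕ) + 1) = insert (σ t : β) (seen σ t) := by
  have : (Finset.univ.filter fun i : Fin (numEdges G) => (i : ℕ) < (t : ℕ) + 1) =
      insert t (Finset.univ.filter fun i : Fin (numEdges G) => (i : ℕ) < t) := by
    ext i
    simp only [Finset.mem_filter, Finset.mem_univ, true_and, Finset.mem_insert, Fin.ext_iff]
    omega
  rw [seen, this, Finset.image_insert, seen]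

/-- The set of the first `t` edges does not depend on their order. -/
theorem seen_trans (π : Equiv.Perm (Fin (numEdges G))) {t : ℕ}
    (hπ : ∀ i : Fin (numEdges G), t ≤ (i : ℕ) → π i = i) : seen (π.trans σ) t = seen σ t := by
  have hlt : ∀ i : Fin (numEdges G), (π i : ℕ) < t ↔ (i : ℕ) < t := by
    intro i
    constructor
    · intro h
      by_contra hi
      rw [hπ i (by omega)] at h
      exact hi h
    · intro h
      by_contra hi
      have := π.injective (hπ (π i) (by omega))
      rw [this] at hi
      exact hi h
  ext e
  simp only [seen, Finset.mem_image, Finset.mem_filter, Finset.mem_univ, true_and,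
    Equiv.trans_apply]
  constructor
  · rintro ⟨i, hi, rfl⟩
    exact ⟨π i, (hlt i).2 hi, rfl⟩
  · rintro ⟨i, hi, rfl⟩
    refine ⟨π.symm i, (hlt _).1 ?_, ?_⟩ <;> simp [hi]

end Seen

section Run

variable [LinearOrder α] [DecidableEq β] (G : Graph α β) [Fintype G.edgeSet]
  (forest : Finset β → Finset β) (σ : Fin (numEdges G) ≃ G.edgeSet)
  (coin : Fin (numEdges G) → Bool)

/-- The edge that arrives at time `t` is added to the candidate set `A*`. -/
def Picked (t : Fin (numEdges G)) : Prop :=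
  sampleSize G ≤ (t : ℕ) ∧ (σ t : β) ∈ forest (seen σ (t + 1)) ∧
    ∃ a, IsTail G (forest (seen σ (t + 1))) (σ t) a ∧
      (stateAfter G forest σ coin t).selected a = none

theorem stateAfter_observed (t : ℕ) : (stateAfter G forest σ coin t).observed = seen σ t := by
  induction t with
  | zero => simp [stateAfter, State.init, seen]
  | succ t ih =>
    by_cases h : t < numEdges G
    · have hs := seen_succ (σ := σ) ⟨t, h⟩
      simp only at hs
      rw [stateAfter, dif_pos h, hs]
      simp only [observe, process]
      split_ifs <;> simp [ih]
    · rw [stateAfter, dif_neg h, ih, seen, seen]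
      congr 1
      ext i
      have := i.2
      simp only [Finset.mem_filter, Finset.mem_univ, true_and]
      omega

open Classical in
theorem stateAfter_succ (t : Fin (numEdges G)) :
    stateAfter G forest σ coin ((t : ℕ) + 1) =
      let s := stateAfter G forest σ coin t
      if Picked G forest σ coin t then
        { observed := seen σ (t + 1)
          candidates := insert (σ t : β) s.candidates
          accepted :=
            if ClosesCycle G s.candidates (σ t) then
              if ClosesCycle G s.accepted (σ t) then s.accepted
              else insert (σ t : β) s.accepted
            else
              if coin t then insert (σ t : β) s.accepted else s.accepted
          selected := fun a =>
            if IsTail G (forest (seen σ (t + 1))) (σ t) a then some (σ t : β) else s.selected a }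
      else { s with observed := seen σ (t + 1) } := by
  have hobs := stateAfter_observed G forest σ coin t
  rw [stateAfter, dif_pos t.2]
  simp only [Picked, process, observe, hobs, ← seen_succ, ← not_lt, sampleSize, Fin.eta]
  by_cases h : (t : ℕ) < ⌊(numEdges G : ℝ) / Real.exp 1⌋₊
  · simp [h]
  · simp only [h, if_false, not_false_iff, true_and]

theorem stateAfter_succ_of_le {t : ℕ} (ht : numEdges G ≤ t) :
    stateAfter G forest σ coin (t + 1) = stateAfter G forest σ coin t := by
  rw [stateAfter, dif_neg (by omega)]

/-- The candidates and the selected edges do not depend on the coin flips. -/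
theorem stateAfter_coin_indep (coin' : Fin (numEdges G) → Bool) (t : ℕ) :
    (stateAfter G forest σ coin t).candidates = (stateAfter G forest σ coin' t).candidates ∧
      (stateAfter G forest σ coin t).selected = (stateAfter G forest σ coin' t).selected := by
  induction t with
  | zero => exact ⟨rfl, rfl⟩
  | succ t ih =>
    rcases lt_or_ge t (numEdges G) with h | h
    · have h1 := stateAfter_succ G forest σ coin ⟨t, h⟩
      have h2 := stateAfter_succ G forest σ coin' ⟨t, h⟩
      have hp : Picked G forest σ coin ⟨t, h⟩ ↔ Picked G forest σ coin' ⟨t, h⟩ := by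
        simp only [Picked, ih.2]
      simp only at h1 h2
      rw [h1, h2]
      by_cases hpk : Picked G forest σ coin' ⟨t, h⟩
      · simp [hp, hpk, ih]
      · simp [hp, hpk, ih]
    · rw [stateAfter_succ_of_le _ _ _ _ h, stateAfter_succ_of_le _ _ _ _ h]
      exact ih

theorem picked_coin_indep (coin' : Fin (numEdges G) → Bool) (t : Fin (numEdges G)) :
    Picked G forest σ coin t ↔ Picked G forest σ coin' t := by
  simp only [Picked, (stateAfter_coin_indep G forest σ coin coin' t).2]

variable {G forest σ coin}

theorem candidates_succ_of_picked {t : Fin (numEdges G)} (h : Picked G forest σ coin t) :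
    (stateAfter G forest σ coin (t + 1)).candidates =
      insert (σ t : β) (stateAfter G forest σ coin t).candidates := by
  rw [stateAfter_succ]
  simp [h]

theorem candidates_succ_of_not_picked {t : Fin (numEdges G)} (h : ¬ Picked G forest σ coin t) :
    (stateAfter G forest σ coin (t + 1)).candidates =
      (stateAfter G forest σ coin t).candidates := by
  rw [stateAfter_succ]
  simp [h]

theorem mem_candidates {t : ℕ} {e : β} :
    e ∈ (stateAfter G forest σ coin t).candidates ↔
      ∃ s : Fin (numEdges G), (s : ℕ) < t ∧ Picked G forest σ coin s ∧ (σ s : β) = e := by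
  induction t with
  | zero => simp [stateAfter, State.init]
  | succ t ih =>
    rcases lt_or_ge t (numEdges G) with h | h
    · have hc : e ∈ (stateAfter G forest σ coin (t + 1)).candidates ↔
          (Picked G forest σ coin ⟨t, h⟩ ∧ (σ ⟨t, h⟩ : β) = e) ∨
            e ∈ (stateAfter G forest σ coin t).candidates := by
        by_cases hp : Picked G forest σ coin ⟨t, h⟩
        · have := candidates_succ_of_picked hp
          simp only at this
          rw [this]
          simp [hp, eq_comm]
        · have := candidates_succ_of_not_picked hp
          simp only at this
          rw [this]
          simp [hp]
      rw [hc, ih]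
      constructor
      · rintro (⟨h1, h2⟩ | ⟨s, h1, h2⟩)
        · exact ⟨⟨t, h⟩, Nat.lt_succ_self t, h1, h2⟩
        · exact ⟨s, by omega, h2⟩
      · rintro ⟨s, h1, h2⟩
        rcases Nat.lt_succ_iff_lt_or_eq.1 h1 with h3 | h3
        · exact Or.inr ⟨s, h3, h2⟩
        · left
          rwa [show s = ⟨t, h⟩ from Fin.ext h3] at h2
    · rw [stateAfter_succ_of_le _ _ _ _ h, ih]
      constructor
      · rintro ⟨s, h1, h2⟩
        exact ⟨s, by omega, h2⟩
      · rintro ⟨s, h1, h2⟩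
        exact ⟨s, by omega, h2⟩

theorem mem_candidates_apply {t : ℕ} {s : Fin (numEdges G)} :
    (σ s : β) ∈ (stateAfter G forest σ coin t).candidates ↔
      (s : ℕ) < t ∧ Picked G forest σ coin s := by
  rw [mem_candidates]
  constructor
  · rintro ⟨r, h1, h2, h3⟩
    rw [← σ.injective (Subtype.ext h3)]
    exact ⟨h1, h2⟩
  · rintro ⟨h1, h2⟩
    exact ⟨s, h1, h2, rfl⟩

theorem candidates_mono {s t : ℕ} (h : s ≤ t) :
    (stateAfter G forest σ coin s).candidates ⊆ (stateAfter G forest σ coin t).candidates := by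
  intro e he
  obtain ⟨r, h1, h2⟩ := mem_candidates.1 he
  exact mem_candidates.2 ⟨r, by omega, h2⟩

theorem accepted_subset_candidates (t : ℕ) :
    (stateAfter G forest σ coin t).accepted ⊆ (stateAfter G forest σ coin t).candidates := by
  induction t with
  | zero => simp [stateAfter, State.init]
  | succ t ih =>
    rcases lt_or_ge t (numEdges G) with h | h
    · have h1 := stateAfter_succ G forest σ coin ⟨t, h⟩
      simp only at h1
      rw [h1]
      split_ifs <;> simp only <;>
        first
        | exact ih
        | exact Finset.insert_subset_insert _ ih
        | exact ih.trans (Finset.subset_insert _ _)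
    · rw [stateAfter_succ_of_le _ _ _ _ h]
      exact ih

theorem mem_accepted_succ_of_ne {t : ℕ} {s : Fin (numEdges G)} (hst : (s : ℕ) ≠ t) :
    (σ s : β) ∈ (stateAfter G forest σ coin (t + 1)).accepted ↔
      (σ s : β) ∈ (stateAfter G forest σ coin t).accepted := by
  rcases lt_or_ge t (numEdges G) with h | h
  · have h1 := stateAfter_succ G forest σ coin ⟨t, h⟩
    have hne : (σ s : β) ≠ σ ⟨t, h⟩ := by
      intro h2
      exact hst (congrArg Fin.val (σ.injective (Subtype.ext h2)))
    simp only at h1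
    rw [h1]
    split_ifs <;> simp [hne]
  · rw [stateAfter_succ_of_le _ _ _ _ h]

/-- Whether an edge is accepted is decided when it arrives. -/
theorem mem_accepted_iff {t : ℕ} {s : Fin (numEdges G)} (hst : (s : ℕ) < t) :
    (σ s : β) ∈ (stateAfter G forest σ coin t).accepted ↔
      (σ s : β) ∈ (stateAfter G forest σ coin (s + 1)).accepted := by
  induction t, (show (s : ℕ) + 1 ≤ t from hst) using Nat.le_induction with
  | base => rfl
  | succ t ht ih => rw [mem_accepted_succ_of_ne (by omega), ih ht]

/-- The accepted edges form a forest at all times. -/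
theorem isForest_accepted (t : ℕ) : IsForest G (stateAfter G forest σ coin t).accepted := by
  induction t with
  | zero => exact isForest_empty G
  | succ t ih =>
    rcases lt_or_ge t (numEdges G) with h | h
    · have h1 := stateAfter_succ G forest σ coin ⟨t, h⟩
      simp only at h1
      rw [h1]
      have hsub := accepted_subset_candidates (G := G) (forest := forest) (σ := σ)
        (coin := coin) t
      split_ifs with h2 h3 h4 h5
      · exact ih
      · exact ih.insert h4
      · exact ih.insert fun h6 => h3 (h6.mono hsub)
      · exact ih
      · exact ih
    · rw [stateAfter_succ_of_le _ _ _ _ h]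
      exact ih

theorem exists_arrival_of_selected {t : ℕ} {a : α}
    (ha : (stateAfter G forest σ coin t).selected a ≠ none) :
    ∃ r : Fin (numEdges G), sampleSize G ≤ (r : ℕ) ∧ (r : ℕ) < t ∧
      (σ r : β) ∈ forest (seen σ (r + 1)) ∧ IsTail G (forest (seen σ (r + 1))) (σ r) a := by
  induction t with
  | zero => exact absurd rfl ha
  | succ t ih =>
    by_cases hsel : (stateAfter G forest σ coin t).selected a = none
    · rcases lt_or_ge t (numEdges G) with h | h
      · have h1 := stateAfter_succ G forest σ coin ⟨t, h⟩
        simp only at h1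
        rw [h1] at ha
        by_cases hp : Picked G forest σ coin ⟨t, h⟩
        · by_cases htail : IsTail G (forest (seen σ (t + 1))) (σ ⟨t, h⟩) a
          · exact ⟨⟨t, h⟩, hp.1, Nat.lt_succ_self t, hp.2.1, htail⟩
          · simp only [hp, if_true, htail, if_false] at ha
            exact absurd hsel ha
        · simp only [hp, if_false] at ha
          exact absurd hsel ha
      · rw [stateAfter_succ_of_le _ _ _ _ h] at ha
        exact absurd hsel ha
    · obtain ⟨r, h2, h3, h4⟩ := ih hsel
      exact ⟨r, h2, Nat.lt_succ_of_lt h3, h4⟩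

theorem exists_selected_of_mem_candidates [G.Loopless]
    (hforest : ∀ S : Finset β, (S : Set β) ⊆ G.edgeSet → IsForest G (forest S)) (t : ℕ) :
    ∀ e ∈ (stateAfter G forest σ coin t).candidates, ∃ a,
      G.Inc e a ∧ (stateAfter G forest σ coin t).selected a = some e := by
  induction t with
  | zero => simp [stateAfter, State.init]
  | succ t ih =>
    rcases lt_or_ge t (numEdges G) with h | h
    · have h1 := stateAfter_succ G forest σ coin ⟨t, h⟩
      simp only at h1
      rw [h1]
      by_cases hp : Picked G forest σ coin ⟨t, h⟩
      · simp only [hp, if_true]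
        obtain ⟨-, hmem, a, htail, hnone⟩ := hp
        simp only at hmem htail hnone
        intro e he
        rcases Finset.mem_insert.1 he with rfl | he
        · exact ⟨a, htail.inc, by simp [htail]⟩
        · obtain ⟨b, hb, hsel⟩ := ih e he
          have hbt : ¬ IsTail G (forest (seen σ (t + 1))) (σ ⟨t, h⟩) b := by
            intro hbt
            rw [hbt.unique (hforest _ (seen_subset _)) hmem htail, hnone] at hsel
            exact absurd hsel (by simp)
          exact ⟨b, hb, by simp [hbt, hsel]⟩
      · simpa only [hp, if_false] using ih
    · rw [stateAfter_succ_of_le _ _ _ _ h]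
      exact ih

/-- Two cycles among the candidates that share an edge have the same edges. -/
theorem candidates_cycle_subset [G.Loopless]
    (hforest : ∀ S : Finset β, (S : Set β) ⊆ G.edgeSet → IsForest G (forest S)) {t : ℕ}
    {k k' : ℕ} {x x' : ℕ → α} {c c' : ℕ → β} (hC : IsCycle G k x c) (hC' : IsCycle G k' x' c')
    (hF : ∀ i < k, c i ∈ (stateAfter G forest σ coin t).candidates)
    (hF' : ∀ i < k', c' i ∈ (stateAfter G forest σ coin t).candidates)
    (hshare : ∃ i < k, ∃ j < k', c i = c' j) :
    ∀ i < k, ∃ j < k', c i = c' j := by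
  have hex : ∀ e, ∃ a, e ∈ (stateAfter G forest σ coin t).candidates →
      G.Inc e a ∧ (stateAfter G forest σ coin t).selected a = some e := by
    intro e
    by_cases he : e ∈ (stateAfter G forest σ coin t).candidates
    · obtain ⟨a, ha⟩ := exists_selected_of_mem_candidates hforest t e he
      exact ⟨a, fun _ => ha⟩
    · exact ⟨x 0, fun h => absurd h he⟩
  choose tail htail using hex
  refine cycle_edges_subset (tail := tail) (fun e he => (htail e he).1) ?_ hC hC' hF hF' hshare
  intro e he e' he' hee
  have h1 := (htail e he).2
  rw [hee, (htail e' he').2] at h1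
  exact (Option.some.inj h1).symm

/-- A candidate that closes no cycle among the candidates is accepted if and only if its coin shows
success. -/
theorem mem_accepted_of_not_closesCycle {t : Fin (numEdges G)} (hp : Picked G forest σ coin t)
    (hc : ¬ ClosesCycle G (stateAfter G forest σ coin t).candidates (σ t)) :
    (σ t : β) ∈ (stateAfter G forest σ coin (t + 1)).accepted ↔ coin t = true := by
  have hnot : (σ t : β) ∉ (stateAfter G forest σ coin t).accepted := fun h =>
    absurd (mem_candidates_apply.1 (accepted_subset_candidates _ h)).1 (lt_irrefl _)
  rw [stateAfter_succ]
  by_cases h : coin t <;> simp [hp, hc, h, hnot]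

/-- Let `C` be a cycle that a candidate closes among the candidates. The candidate is rejected only
if the coins of all the other edges of `C` show success: none of these edges closed a cycle on
arrival, as `C` is the only cycle among the candidates that meets `C`. -/
theorem coin_of_not_mem_accepted [G.Loopless]
    (hforest : ∀ S : Finset β, (S : Set β) ⊆ G.edgeSet → IsForest G (forest S))
    {t : Fin (numEdges G)} (hp : Picked G forest σ coin t)
    {k : ℕ} {x : ℕ → α} {c : ℕ → β} (hC : IsCycle G k x c)
    (hc : ∀ i < k, c i = σ t ∨ c i ∈ (stateAfter G forest σ coin t).candidates)
    (ht : ∃ i < k, c i = σ t)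
    (hrej : (σ t : β) ∉ (stateAfter G forest σ coin (t + 1)).accepted)
    {s : Fin (numEdges G)} (hst : s ≠ t) (hs : ∃ i < k, c i = σ s) : coin s = true := by
  have hclose : ClosesCycle G (stateAfter G forest σ coin t).candidates (σ t) :=
    ⟨k, x, c, hC, hc, ht⟩
  have hcand := candidates_succ_of_picked hp
  have hcC : ∀ i < k, c i ∈ (stateAfter G forest σ coin (t + 1)).candidates := by
    intro i hi
    rw [hcand]
    exact Finset.mem_insert.2 (hc i hi)
  obtain ⟨i, hi, his⟩ := hs
  obtain ⟨p, hpk, hpt⟩ := ht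
  have hne : (σ s : β) ≠ σ t := fun h => hst (σ.injective (Subtype.ext h))
  have hsC : (σ s : β) ∈ (stateAfter G forest σ coin t).candidates := by
    rcases hc i hi with h | h
    · exact absurd (his.symm.trans h) hne
    · rwa [his] at h
  obtain ⟨hlt, hps⟩ := mem_candidates_apply.1 hsC
  -- the rejected edge closes a cycle among the accepted edges, and this cycle must be `C`
  have hacc : ClosesCycle G (stateAfter G forest σ coin t).accepted (σ t) := by
    by_contra h
    rw [stateAfter_succ] at hrej
    simp [hp, hclose, h] at hrej
  obtain ⟨k', x', c', hC', hc', p', hpk', hpt'⟩ := hacc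
  have hcC' : ∀ i < k', c' i ∈ (stateAfter G forest σ coin (t + 1)).candidates := by
    intro i hi
    rw [hcand]
    exact Finset.mem_insert.2 ((hc' i hi).imp_right fun h => accepted_subset_candidates _ h)
  obtain ⟨j, hj, hij⟩ := candidates_cycle_subset hforest hC hC' hcC hcC'
    ⟨p, hpk, p', hpk', hpt.trans hpt'.symm⟩ i hi
  have hsA : (σ s : β) ∈ (stateAfter G forest σ coin t).accepted := by
    rcases hc' j hj with h | h
    · exact absurd (his.symm.trans (hij.trans h)) hne
    · rwa [← hij, his] at h
  rw [mem_accepted_iff hlt] at hsA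
  refine (mem_accepted_of_not_closesCycle hps ?_).1 hsA
  -- a cycle closed by an earlier edge of `C` would contain the later edge `σ t`
  rintro ⟨k'', x'', c'', hC'', hc'', r, hr, hrs⟩
  have hcC'' : ∀ i < k'', c'' i ∈ (stateAfter G forest σ coin t).candidates := by
    intro i hi
    rcases hc'' i hi with h | h
    · rw [h]
      exact hsC
    · exact candidates_mono hlt.le h
  obtain ⟨j, hj, hpj⟩ := candidates_cycle_subset hforest hC hC'' hcC
    (fun i hi => candidates_mono (Nat.le_succ _) (hcC'' i hi))
    ⟨i, hi, r, hr, his.trans hrs.symm⟩ p hpk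
  have := hcC'' j hj
  rw [← hpj, hpt] at this
  exact absurd (mem_candidates_apply.1 this).1 (lt_irrefl _)

end Run

/-! ### Weights of forests -/

theorem weight_nonneg_of_isMaxForest [DecidableEq β] {G : Graph α β} {w : β → ℝ}
    {S T : Finset β} (h : IsMaxForest G w S T) {e : β} (he : e ∈ T) : 0 ≤ w e := by
  obtain ⟨hS, hT, hmax⟩ := h
  have h1 := hmax (T.erase e) ((Finset.erase_subset _ _).trans hS) fun k x c hC => by
    obtain ⟨i, hi, hci⟩ := hT k x c hC
    exact ⟨i, hi, fun h => hci (Finset.mem_of_mem_erase h)⟩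
  have h2 := Finset.add_sum_erase T w he
  rw [weight, weight] at h1
  linarith

theorem exists_isForest_weight_eq_opt (G : Graph α β) [Fintype G.edgeSet] (w : β → ℝ) :
    ∃ F : Finset β, (F : Set β) ⊆ G.edgeSet ∧ IsForest G F ∧ weight w F = opt G w := by
  obtain ⟨F, hF, h⟩ :=
    Finset.exists_mem_eq_sup' (forestsIn_nonempty G G.edgeSet.toFinset) (weight w)
  simp only [forestsIn, Finset.mem_filter, Finset.mem_powerset] at hF
  refine ⟨F, fun e he => ?_, hF.2, h.symm⟩
  simpa using hF.1 he

theorem IsForest.subset {G : Graph α β} {F F' : Finset β} (h : IsForest G F) (hsub : F' ⊆ F) :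
    IsForest G F' :=
  fun k x c hC => by
    obtain ⟨i, hi, hci⟩ := h k x c hC
    exact ⟨i, hi, fun h => hci (hsub h)⟩

theorem sum_Iic_eq_sum_seen [DecidableEq β] {G : Graph α β} [Fintype G.edgeSet]
    (σ : Fin (numEdges G) ≃ G.edgeSet)
    (t : Fin (numEdges G)) (f : β → ℝ) :
    ∑ i ∈ Finset.Iic t, f (σ i) = ∑ e ∈ seen σ (t + 1), f e := by
  rw [seen, Finset.sum_image]
  · refine Finset.sum_congr ?_ fun _ _ => rfl
    ext i
    simp only [Finset.mem_Iic, Finset.mem_filter, Finset.mem_univ, true_and, Fin.le_def]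
    omega
  · intro i _ j _ h
    exact σ.injective (Subtype.ext h)

open Classical in
/-- The expected weight of the edge arriving at time `t`, counted if it belongs to the current
maximum weight forest, is at least `OPT / m`: each of the edges observed so far is equally likely
to be the last one, and the current forest is at least as heavy as the observed part of an optimal
forest. -/
theorem factorial_mul_opt_le [DecidableEq β] {G : Graph α β} [Fintype G.edgeSet]
    {forest : Finset β → Finset β} {w : β → ℝ}
    (hforest : ∀ S : Finset β, (S : Set β) ⊆ G.edgeSet → IsMaxForest G w S (forest S))
    (t : Fin (numEdges G)) :
    (numEdges G).factorial * opt G w ≤ numEdges G * ∑ σ : Fin (numEdges G) ≃ G.edgeSet,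
      (if (σ t : β) ∈ forest (seen σ (t + 1)) then w (σ t) else 0) := by
  obtain ⟨F, hFE, hF, hFw⟩ := exists_isForest_weight_eq_opt G w
  have hswap : ∀ (h : β → Finset β → ℝ),
      ((t : ℝ) + 1) * ∑ σ : Fin (numEdges G) ≃ G.edgeSet, h (σ t) (seen σ (t + 1)) =
        ∑ σ : Fin (numEdges G) ≃ G.edgeSet, ∑ e ∈ seen σ (t + 1), h e (seen σ (t + 1)) := by
    intro h
    have h1 : ∀ i ∈ Finset.Iic t, ∑ σ : Fin (numEdges G) ≃ G.edgeSet, h (σ t) (seen σ (t + 1)) =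
        ∑ σ : Fin (numEdges G) ≃ G.edgeSet, h (σ i) (seen σ (t + 1)) := by
      intro i hi
      have hi := Fin.le_def.1 (Finset.mem_Iic.1 hi)
      rw [← sum_order_trans (Equiv.swap i t)]
      refine Finset.sum_congr rfl fun σ _ => ?_
      rw [seen_trans]
      · simp
      · intro j hj
        refine Equiv.swap_apply_of_ne_of_ne ?_ ?_ <;> rintro rfl <;> omega
    have h2 : ((t : ℝ) + 1) * ∑ σ : Fin (numEdges G) ≃ G.edgeSet, h (σ t) (seen σ (t + 1)) =
        ∑ i ∈ Finset.Iic t, ∑ σ : Fin (numEdges G) ≃ G.edgeSet, h (σ t) (seen σ (t + 1)) := by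
      rw [Finset.sum_const, Fin.card_Iic]
      simp
    rw [h2, Finset.sum_congr rfl h1, Finset.sum_comm]
    refine Finset.sum_congr rfl fun σ _ => ?_
    exact sum_Iic_eq_sum_seen σ t fun e => h e (seen σ (t + 1))
  have hcomp : ∑ σ : Fin (numEdges G) ≃ G.edgeSet, (if (σ t : β) ∈ F then w (σ t) else 0) ≤
      ∑ σ : Fin (numEdges G) ≃ G.edgeSet,
        (if (σ t : β) ∈ forest (seen σ (t + 1)) then w (σ t) else 0) := by
    have ht : (0 : ℝ) < (t : ℝ) + 1 := by positivity
    refine le_of_mul_le_mul_left ?_ ht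
    rw [hswap fun e _ => if e ∈ F then w e else 0,
      hswap fun e S => if e ∈ forest S then w e else 0]
    refine Finset.sum_le_sum fun σ _ => ?_
    obtain ⟨hsub, -, hmax⟩ := hforest (seen σ (t + 1)) (seen_subset _)
    have h1 := hmax (seen σ (t + 1) ∩ F) Finset.inter_subset_left
      (hF.subset Finset.inter_subset_right)
    rw [Finset.sum_ite_mem, Finset.sum_ite_mem, Finset.inter_eq_right.2 hsub]
    exact h1
  have hcount := card_mul_sum_order_apply (E := G.edgeSet) (m := numEdges G)
    (fun e => if (e : β) ∈ F then w e else 0) rfl t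
  have hFsum : ∑ e : G.edgeSet, (if (e : β) ∈ F then w e else 0) = opt G w := by
    rw [← hFw, weight, ← Finset.sum_filter]
    refine Finset.sum_bij (fun e _ => (e : β)) (by simp) (by simp) ?_ (by simp)
    intro e he
    exact ⟨⟨e, hFE he⟩, by simpa using he, rfl⟩
  rw [hFsum] at hcount
  rw [← hcount]
  exact mul_le_mul_of_nonneg_left hcomp (by positivity)

section Gain

variable [LinearOrder α] [DecidableEq β] {G : Graph α β} [Fintype G.edgeSet]
  {forest : Finset β → Finset β} {w : β → ℝ}

/-! ### Every candidate is accepted with probability at least `x_g` -/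

open Classical in
/-- Given the order of the edges, a candidate is accepted with probability at least `ρ`, if `ρ` is
the root `x_g`. A candidate that closes no cycle among the candidates is accepted with probability
`ρ`. A candidate that closes a cycle, of length `k ≥ g`, is rejected with probability at most
`ρ ^ (k - 1) ≤ ρ ^ (g - 1) = 1 - ρ`. -/
theorem le_sum_coinProb_accepted [G.Loopless]
    (hforest : ∀ S : Finset β, (S : Set β) ⊆ G.edgeSet → IsForest G (forest S))
    {g : ℕ} (hg : GirthAtLeast G g) {ρ : ℝ} (hρ : ρ ∈ rootSet g)
    (σ : Fin (numEdges G) ≃ G.edgeSet) (coin₀ : Fin (numEdges G) → Bool)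
    {t : Fin (numEdges G)} (hp : Picked G forest σ coin₀ t) :
    ρ ≤ ∑ coin : Fin (numEdges G) → Bool,
      coinProb ρ coin * (if (σ t : β) ∈ output G forest σ coin then 1 else 0) := by
  obtain ⟨h0, h1, hroot⟩ := hρ
  have hpk : ∀ coin, Picked G forest σ coin t := fun coin =>
    (picked_coin_indep G forest σ coin coin₀ t).2 hp
  have hout : ∀ coin, (σ t : β) ∈ output G forest σ coin ↔
      (σ t : β) ∈ (stateAfter G forest σ coin (t + 1)).accepted :=
    fun coin => mem_accepted_iff t.2
  simp only [hout]
  by_cases hc : ClosesCycle G (stateAfter G forest σ coin₀ t).candidates (σ t)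
  · obtain ⟨k, x, c, hC, hcc, ht⟩ := hc
    set I : Finset (Fin (numEdges G)) :=
      Finset.univ.filter fun s => s ≠ t ∧ ∃ i < k, c i = σ s with hI
    have hcard : g - 1 ≤ I.card := by
      have hgk := hg k x c hC
      have h2 : ((Finset.range k).image c).card = k := by
        rw [Finset.card_image_of_injOn, Finset.card_range]
        simpa [Set.InjOn] using hC.edge_inj
      have h3 : ((Finset.range k).image c).erase (σ t) ⊆ I.image fun s => (σ s : β) := by
        intro e he
        obtain ⟨hne, he⟩ := Finset.mem_erase.1 he
        obtain ⟨i, hi, rfl⟩ := Finset.mem_image.1 he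
        have hi := Finset.mem_range.1 hi
        obtain ⟨s, hs⟩ := σ.surjective ⟨c i, (hC.isLink i hi).edge_mem⟩
        have hs' : (σ s : β) = c i := by rw [hs]
        refine Finset.mem_image.2 ⟨s, Finset.mem_filter.2 ⟨Finset.mem_univ _, ?_, i, hi, hs'.symm⟩,
          hs'⟩
        rintro rfl
        exact hne hs'.symm
      have h4 := Finset.pred_card_le_card_erase (s := (Finset.range k).image c) (a := (σ t : β))
      have h5 := (Finset.card_le_card h3).trans Finset.card_image_le
      omega
    have hle : ∀ coin : Fin (numEdges G) → Bool,
        coinProb ρ coin - coinProb ρ coin * (if ∀ s ∈ I, coin s = true then 1 else 0) ≤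
          coinProb ρ coin *
            (if (σ t : β) ∈ (stateAfter G forest σ coin (t + 1)).accepted then 1 else 0) := by
      intro coin
      have hn := coinProb_nonneg h0 h1 coin
      by_cases hacc : (σ t : β) ∈ (stateAfter G forest σ coin (t + 1)).accepted
      · rw [if_pos hacc]
        split_ifs <;> simp [hn]
      · have hcoin : ∀ s ∈ I, coin s = true := by
          intro s hs
          obtain ⟨-, hst, hs⟩ := Finset.mem_filter.1 hs
          rw [← (stateAfter_coin_indep G forest σ coin coin₀ t).1] at hcc
          exact coin_of_not_mem_accepted hforest (hpk coin) hC hcc ht hacc hst hs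
        rw [if_neg hacc, if_pos hcoin]
        simp
    have hsum := Finset.sum_le_sum fun coin (_ : coin ∈ Finset.univ) => hle coin
    rw [Finset.sum_sub_distrib, sum_coinProb] at hsum
    have hpow : ρ ^ I.card ≤ ρ ^ (g - 1) := pow_le_pow_of_le_one h0 h1 hcard
    rw [sum_coinProb_forall_mem ρ I] at hsum
    linarith
  · have hiff : ∀ coin, (σ t : β) ∈ (stateAfter G forest σ coin (t + 1)).accepted ↔
        ∀ s ∈ ({t} : Finset (Fin (numEdges G))), coin s = true := by
      intro coin
      rw [← (stateAfter_coin_indep G forest σ coin coin₀ t).1] at hc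
      simpa using mem_accepted_of_not_closesCycle (hpk coin) hc
    simp only [hiff]
    rw [sum_coinProb_forall_mem, Finset.card_singleton, pow_one]

/-! ### The expected weight of the candidates -/

open Classical in
/-- The expected weight of the edge arriving at time `t`, counted if it becomes a candidate. -/
theorem mul_opt_le_sum_picked [G.Loopless]
    (hforest : ∀ S : Finset β, (S : Set β) ⊆ G.edgeSet → IsMaxForest G w S (forest S))
    (coin : Fin (numEdges G) → Bool) (t : Fin (numEdges G)) (ht : sampleSize G ≤ (t : ℕ)) :
    (if (t : ℕ) = sampleSize G then 1 else (sampleSize G : ℝ) / t) *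
        ((numEdges G).factorial * opt G w) ≤
      numEdges G * ∑ σ : Fin (numEdges G) ≃ G.edgeSet,
        (if Picked G forest σ coin t then w (σ t) else 0) := by
  set q := sampleSize G with hq
  set Ψ : (Fin (numEdges G) ≃ G.edgeSet) → ℝ := fun σ =>
    if (σ t : β) ∈ forest (seen σ (t + 1)) then w (σ t) else 0 with hΨ
  -- the edge at time `r` blocks the tail of the edge at time `t`
  set D : Fin (numEdges G) → (Fin (numEdges G) ≃ G.edgeSet) → Prop := fun r σ =>
    (σ t : β) ∈ forest (seen σ (t + 1)) ∧ (σ r : β) ∈ forest (seen σ (r + 1)) ∧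
      ∃ a, IsTail G (forest (seen σ (t + 1))) (σ t) a ∧
        IsTail G (forest (seen σ (r + 1))) (σ r) a with hD
  have hmax : ∀ σ : Fin (numEdges G) ≃ G.edgeSet, ∀ s,
      IsMaxForest G w (seen σ s) (forest (seen σ s)) := fun σ s => hforest _ (seen_subset s)
  have hΨ0 : ∀ σ, 0 ≤ Ψ σ := by
    intro σ
    simp only [hΨ]
    split_ifs with h
    · exact weight_nonneg_of_isMaxForest (hmax σ _) h
    · exact le_rfl
  have hopt : (numEdges G).factorial * opt G w ≤ numEdges G * ∑ σ, Ψ σ :=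
    factorial_mul_opt_le hforest t
  have hpick : ∀ σ, Ψ σ * (if ∀ r : Fin (numEdges G), q ≤ (r : ℕ) → (r : ℕ) < t → ¬ D r σ
      then 1 else 0) ≤ if Picked G forest σ coin t then w (σ t) else 0 := by
    intro σ
    by_cases hp : Picked G forest σ coin t
    · have h1 : Ψ σ = w (σ t) := if_pos hp.2.1
      rw [if_pos hp, ← h1]
      exact mul_le_of_le_one_right (hΨ0 σ) (by split_ifs <;> norm_num)
    · rw [if_neg hp]
      refine le_of_eq ?_
      by_cases hT : (σ t : β) ∈ forest (seen σ (t + 1))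
      · rw [if_neg, mul_zero]
        intro hall
        obtain ⟨a, ha⟩ := exists_isTail hT (σ t).2
        refine hp ⟨ht, hT, a, ha, ?_⟩
        by_contra hsel
        obtain ⟨r, hqr, hrt, hrT, hra⟩ := exists_arrival_of_selected hsel
        exact hall r hqr hrt ⟨hT, hrT, a, ha, hra⟩
      · simp [hΨ, hT]
  have hsum := Finset.sum_le_sum fun σ (_ : σ ∈ Finset.univ) => hpick σ
  have hm : (0 : ℝ) ≤ numEdges G := by positivity
  by_cases htq : (t : ℕ) = q
  · rw [if_pos htq, one_mul]
    refine hopt.trans (mul_le_mul_of_nonneg_left (le_trans ?_ hsum) hm)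
    refine Finset.sum_le_sum fun σ _ => le_of_eq ?_
    rw [if_pos (fun r h1 h2 => absurd h1 (by omega)), mul_one]
  · rw [if_neg htq]
    have htpos : (0 : ℝ) < (t : ℕ) := by
      have : 0 < (t : ℕ) := by omega
      exact_mod_cast this
    have hsurv := mul_sum_le_mul_sum_of_harm D ht t.2.le ?_ ?_ Ψ hΨ0 ?_
    · rw [div_mul_eq_mul_div, div_le_iff₀ htpos]
      calc (q : ℝ) * ((numEdges G).factorial * opt G w)
          ≤ q * (numEdges G * ∑ σ, Ψ σ) := by gcongr
        _ = numEdges G * (q * ∑ σ, Ψ σ) := by ring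
        _ ≤ numEdges G * ((t : ℕ) * _) :=
          mul_le_mul_of_nonneg_left (hsurv.trans (mul_le_mul_of_nonneg_left hsum htpos.le)) hm
        _ = _ := by ring
    · intro r hr π hπ σ
      have h1 : seen (π.trans σ) (t + 1) = seen σ (t + 1) :=
        seen_trans π fun i hi => hπ i (Fin.le_def.2 (by omega))
      have h2 : seen (π.trans σ) (r + 1) = seen σ (r + 1) :=
        seen_trans π fun i hi => hπ i (Fin.le_def.2 (by omega))
      have h3 : π t = t := hπ t (Fin.le_def.2 hr.le)
      have h4 : π r = r := hπ r le_rfl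
      simp only [hD, h1, h2, Equiv.trans_apply, h3, h4]
    · intro r hr σ
      refine Finset.card_le_one.2 ?_
      have hfix : ∀ i ∈ Finset.Iic r, seen ((Equiv.swap i r).trans σ) (t + 1) = seen σ (t + 1) ∧
          seen ((Equiv.swap i r).trans σ) (r + 1) = seen σ (r + 1) ∧ Equiv.swap i r t = t := by
        intro i hi
        have hi := Fin.le_def.1 (Finset.mem_Iic.1 hi)
        refine ⟨seen_trans _ fun j hj => ?_, seen_trans _ fun j hj => ?_, ?_⟩ <;>
          refine Equiv.swap_apply_of_ne_of_ne ?_ ?_ <;> rintro rfl <;> omega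
      intro i hi j hj
      obtain ⟨hi, hi'⟩ := Finset.mem_filter.1 hi
      obtain ⟨hj, hj'⟩ := Finset.mem_filter.1 hj
      simp only [hD, hfix i hi, Equiv.trans_apply, Equiv.swap_apply_right] at hi'
      simp only [hD, hfix j hj, Equiv.trans_apply, Equiv.swap_apply_right] at hj'
      obtain ⟨hT, hiT, a, ha, hia⟩ := hi'
      obtain ⟨-, hjT, b, hb, hjb⟩ := hj'
      rw [hb.unique (hmax σ _).2.1 hT ha] at hjb
      exact σ.injective (Subtype.ext (hia.edge_unique (hmax σ _).2.1 hiT hjT hjb))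
    · intro π hπ σ
      have h1 : seen (π.trans σ) (t + 1) = seen σ (t + 1) :=
        seen_trans π fun i hi => hπ i (by omega)
      simp only [hΨ, h1, Equiv.trans_apply, hπ t le_rfl]

open Classical in
theorem weight_eq_sum_picked {σ : Fin (numEdges G) ≃ G.edgeSet}
    (coin : Fin (numEdges G) → Bool) (f : β → ℝ) {A : Finset β}
    (hA : A ⊆ (stateAfter G forest σ coin (numEdges G)).candidates) :
    weight f A = ∑ t : Fin (numEdges G),
      if Picked G forest σ coin t then f (σ t) * (if (σ t : β) ∈ A then 1 else 0) else 0 := by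
  have h1 : ∀ t : Fin (numEdges G),
      (if Picked G forest σ coin t then f (σ t) * (if (σ t : β) ∈ A then 1 else 0) else 0) =
        if (σ t : β) ∈ A then f (σ t) else 0 := by
    intro t
    by_cases ht : (σ t : β) ∈ A
    · have := (mem_candidates_apply.1 (hA ht)).2
      simp [ht, this]
    · simp [ht]
  rw [Finset.sum_congr rfl fun t _ => h1 t, weight, ← Finset.sum_filter]
  symm
  refine Finset.sum_bij (fun t _ => (σ t : β)) (by simp) ?_ ?_ (by simp)
  · intro s _ t _ h
    exact σ.injective (Subtype.ext h)
  · intro e he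
    obtain ⟨s, -, -, rfl⟩ := mem_candidates.1 (hA he)
    exact ⟨s, by simpa using he, rfl⟩

open Classical in
/-- The coins reduce the expected weight of the candidates by a factor of at least `x_g`. -/
theorem mul_sum_picked_le [G.Loopless]
    (hforest : ∀ S : Finset β, (S : Set β) ⊆ G.edgeSet → IsMaxForest G w S (forest S))
    {g : ℕ} (hg : GirthAtLeast G g) {ρ : ℝ} (hρ : ρ ∈ rootSet g)
    (coin₀ : Fin (numEdges G) → Bool) (σ : Fin (numEdges G) ≃ G.edgeSet) :
    ρ * ∑ t, (if Picked G forest σ coin₀ t then w (σ t) else 0) ≤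
      ∑ coin : Fin (numEdges G) → Bool, coinProb ρ coin * weight w (output G forest σ coin) := by
  have h1 : ∀ coin, weight w (output G forest σ coin) = ∑ t : Fin (numEdges G),
      if Picked G forest σ coin₀ t then
        w (σ t) * (if (σ t : β) ∈ output G forest σ coin then 1 else 0) else 0 := by
    intro coin
    rw [weight_eq_sum_picked coin w (A := output G forest σ coin) (accepted_subset_candidates _)]
    exact Finset.sum_congr rfl fun t _ => by simp only [picked_coin_indep G forest σ coin coin₀ t]
  simp only [h1, Finset.mul_sum]
  rw [Finset.sum_comm]
  refine Finset.sum_le_sum fun t _ => ?_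
  by_cases hp : Picked G forest σ coin₀ t
  · have hw : 0 ≤ w (σ t) := weight_nonneg_of_isMaxForest (hforest _ (seen_subset _)) hp.2.1
    have h2 := le_sum_coinProb_accepted (fun S hS => (hforest S hS).2.1) hg hρ σ coin₀ hp
    simp only [hp, if_true]
    calc ρ * w (σ t) ≤ (∑ coin : Fin (numEdges G) → Bool,
          coinProb ρ coin * (if (σ t : β) ∈ output G forest σ coin then 1 else 0)) * w (σ t) :=
        mul_le_mul_of_nonneg_right h2 hw
      _ = _ := by
        rw [Finset.sum_mul]
        exact Finset.sum_congr rfl fun coin _ => by ring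
  · simp [hp]

/-- The expected gain in terms of the classical secretary sum. -/
theorem mul_opt_le_expectedGain [G.Loopless]
    (hforest : ∀ S : Finset β, (S : Set β) ⊆ G.edgeSet → IsMaxForest G w S (forest S))
    {g : ℕ} (hg : GirthAtLeast G g) {ρ : ℝ} (hρ : ρ ∈ rootSet g) :
    ρ * ((∑ t ∈ Finset.Ico (sampleSize G) (numEdges G),
      if t = sampleSize G then 1 else (sampleSize G : ℝ) / t) * opt G w) ≤
        numEdges G * expectedGain G w forest ρ := by
  classical
  have hfac : (0 : ℝ) < (numEdges G).factorial := by exact_mod_cast Nat.factorial_pos _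
  set coin₀ : Fin (numEdges G) → Bool := fun _ => false
  set P : ℕ → ℝ := fun t => if t = sampleSize G then 1 else (sampleSize G : ℝ) / t with hP
  have h1 : (∑ t ∈ Finset.Ico (sampleSize G) (numEdges G), P t) *
      ((numEdges G).factorial * opt G w) ≤ numEdges G * ∑ σ : Fin (numEdges G) ≃ G.edgeSet,
        ∑ t, (if Picked G forest σ coin₀ t then w (σ t) else 0) := by
    have h2 : ∑ t ∈ Finset.Ico (sampleSize G) (numEdges G), P t =
        ∑ t : Fin (numEdges G), if sampleSize G ≤ (t : ℕ) then P t else 0 := by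
      rw [Fin.sum_univ_eq_sum_range (fun t => if sampleSize G ≤ t then P t else 0),
        ← Finset.sum_filter]
      refine Finset.sum_congr ?_ fun _ _ => rfl
      ext t
      simp [and_comm]
    rw [h2, Finset.sum_mul, Finset.sum_comm, Finset.mul_sum]
    refine Finset.sum_le_sum fun t _ => ?_
    by_cases ht : sampleSize G ≤ (t : ℕ)
    · rw [if_pos ht]
      exact mul_opt_le_sum_picked hforest coin₀ t ht
    · have hnp : ∀ σ, ¬ Picked G forest σ coin₀ t := fun σ h => ht h.1
      simp [ht, hnp]
  have h3 : ρ * ∑ σ : Fin (numEdges G) ≃ G.edgeSet,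
      ∑ t, (if Picked G forest σ coin₀ t then w (σ t) else 0) ≤
        (numEdges G).factorial * expectedGain G w forest ρ := by
    rw [expectedGain, mul_div_cancel₀ _ hfac.ne', Finset.mul_sum]
    exact Finset.sum_le_sum fun σ _ => mul_sum_picked_le hforest hg hρ coin₀ σ
  refine le_of_mul_le_mul_left ?_ hfac
  calc ((numEdges G).factorial : ℝ) *
        (ρ * ((∑ t ∈ Finset.Ico (sampleSize G) (numEdges G), P t) * opt G w))
      = ρ * ((∑ t ∈ Finset.Ico (sampleSize G) (numEdges G), P t) *
          ((numEdges G).factorial * opt G w)) := by ring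
    _ ≤ ρ * (numEdges G * _) := mul_le_mul_of_nonneg_left h1 hρ.1
    _ = numEdges G * (ρ * _) := by ring
    _ ≤ numEdges G * _ := mul_le_mul_of_nonneg_left h3 (by positivity)
    _ = _ := by ring

end Gain

/-! ### The classical secretary sum -/

/-- The trapezoid rule for `1 / x` on `[s, s + 1]`; it is `y ≤ sinh y` at `y = log ((s + 1) / s)`. -/
theorem log_succ_div_le {s : ℝ} (hs : 0 < s) :
    Real.log ((s + 1) / s) ≤ (1 / s + 1 / (s + 1)) / 2 := by
  have h1 : (1 : ℝ) ≤ (s + 1) / s := by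
    rw [le_div_iff₀ hs]
    linarith
  have h2 := Real.self_le_sinh_iff.2 (Real.log_nonneg h1)
  rw [Real.sinh_log (by linarith)] at h2
  refine h2.trans (le_of_eq ?_)
  field_simp
  ring

theorem log_div_add_le_sum_inv {q m : ℕ} (hq : 0 < q) (hqm : q ≤ m) :
    Real.log (m / q) + (1 / q - 1 / m) / 2 ≤ ∑ t ∈ Finset.Ico q m, 1 / (t : ℝ) := by
  have hq' : (0 : ℝ) < q := by exact_mod_cast hq
  induction m, hqm using Nat.le_induction with
  | base => simp [hq'.ne']
  | succ m hqm ih =>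
    have hm : (0 : ℝ) < m := by exact_mod_cast lt_of_lt_of_le hq hqm
    rw [Finset.sum_Ico_succ_top hqm]
    have h1 := log_succ_div_le hm
    have h2 : Real.log (((m + 1 : ℕ) : ℝ) / q) = Real.log (m / q) + Real.log ((m + 1) / m) := by
      rw [← Real.log_mul (by positivity) (by positivity)]
      congr 1
      push_cast
      field_simp
    rw [h2]
    push_cast
    linarith

/-- Skipping the first `⌊m / e⌋` of `m` candidates succeeds in the secretary problem with
probability at least `1 / e`, for every `m`; here the sum is `m` times this probability. With
`M = m / e` and `q = ⌊M⌋`, the trapezoid bound for the harmonic sum and `log y ≤ y - 1` leave an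
error of `(M - q) ^ 2 / M < e / m`, which is at most the correction term `(1 - q / m) / 2` of the
trapezoid bound as soon as `m ≥ 9`. -/
theorem div_exp_le_secretary_sum {m : ℕ} (hm : 0 < m) :
    (m : ℝ) / Real.exp 1 ≤ ∑ t ∈ Finset.Ico ⌊(m : ℝ) / Real.exp 1⌋₊ m,
      if t = ⌊(m : ℝ) / Real.exp 1⌋₊ then 1 else ((⌊(m : ℝ) / Real.exp 1⌋₊ : ℕ) : ℝ) / t := by
  have he1 := Real.exp_one_gt_d9
  have he2 := Real.exp_one_lt_d9
  have he : (0 : ℝ) < Real.exp 1 := Real.exp_pos 1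
  rcases Nat.lt_or_ge m 9 with hm9 | hm9
  · have hfloor : ⌊(m : ℝ) / Real.exp 1⌋₊ = m / 3 := by
      rw [Nat.floor_eq_iff (by positivity), le_div_iff₀ he, div_lt_iff₀ he]
      interval_cases m <;> norm_num <;> (try constructor) <;> linarith
    rw [hfloor, div_le_iff₀ he]
    interval_cases m <;> norm_num [Finset.sum_Ico_eq_sum_range, Finset.sum_range_succ] <;> linarith
  · set M : ℝ := (m : ℝ) / Real.exp 1 with hM
    set q : ℕ := ⌊M⌋₊ with hqdef
    have hmR : (9 : ℝ) ≤ m := by exact_mod_cast hm9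
    have hmM : (m : ℝ) = M * Real.exp 1 := by
      rw [hM]
      field_simp
    have hM3 : 3 < M := by
      rw [hM, lt_div_iff₀ he]
      linarith
    have hM0 : (0 : ℝ) < M := by linarith
    have hqM : (q : ℝ) ≤ M := Nat.floor_le hM0.le
    have hMq : M < q + 1 := Nat.lt_floor_add_one M
    have hqR : (0 : ℝ) < q := by linarith
    have hq : 0 < q := by exact_mod_cast hqR
    have hqm : q ≤ m := by
      have : (q : ℝ) ≤ m := by
        rw [hmM]
        nlinarith
      exact_mod_cast this
    have hterm : ∀ t ∈ Finset.Ico q m, (if t = q then (1 : ℝ) else (q : ℝ) / t) =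
        q * (1 / (t : ℝ)) := by
      intro t _
      split_ifs with h
      · rw [h]
        field_simp
      · ring
    rw [Finset.sum_congr rfl hterm, ← Finset.mul_sum]
    have h1 := log_div_add_le_sum_inv hq hqm
    have h2 : 2 - q / M ≤ Real.log (m / q) := by
      have h3 : (m : ℝ) / q = Real.exp 1 / (q / M) := by
        rw [hmM]
        field_simp
      rw [h3, Real.log_div he.ne' (by positivity), Real.log_exp]
      have := Real.log_le_sub_one_of_pos (show (0 : ℝ) < q / M by positivity)
      linarith
    have hmul := mul_le_mul_of_nonneg_left h1 hqR.le
    have hmul2 := mul_le_mul_of_nonneg_left h2 hqR.le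
    refine le_trans ?_ hmul
    have key : (M - q) ^ 2 / M ≤ (1 - q / m) / 2 := by
      have hqm' : (q : ℝ) / m ≤ 1 / Real.exp 1 := by
        rw [div_le_div_iff₀ (by linarith) he, hmM]
        nlinarith
      have h4 : 1 / Real.exp 1 ≤ (0.368 : ℝ) := by
        rw [div_le_iff₀ he]
        linarith
      rw [div_le_iff₀ hM0]
      nlinarith
    have h5 : (q : ℝ) * (2 - q / M) = M - (M - q) ^ 2 / M := by
      field_simp
      ring
    have h6 : (q : ℝ) * ((1 / q - 1 / m) / 2) = (1 - q / m) / 2 := by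
      field_simp
    rw [mul_add, h6]
    linarith

/-! ### The root `x_g` -/

theorem root_strictAnti {n : ℕ} {x y : ℝ} (hx : 0 ≤ x) (hxy : x < y) :
    1 - y - y ^ n < 1 - x - x ^ n := by
  have := pow_le_pow_left₀ hx hxy.le n
  linarith

theorem rootSet_eq_singleton {g : ℕ} (hg : 2 ≤ g) : rootSet g = {xRoot g} := by
  have hcont : ContinuousOn (fun x : ℝ => 1 - x - x ^ (g - 1)) (Set.Icc 0 1) := by fun_prop
  have hmem : (0 : ℝ) ∈ Set.Icc (1 - (1 : ℝ) - 1 ^ (g - 1)) (1 - 0 - 0 ^ (g - 1)) := by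
    rw [zero_pow (by omega)]
    norm_num
  obtain ⟨x, ⟨hx0, hx1⟩, hx⟩ := intermediate_value_Icc' zero_le_one hcont hmem
  have hs : rootSet g = {x} := by
    ext y
    simp only [rootSet, Set.mem_ofPred_eq, Set.mem_singleton_iff]
    constructor
    · rintro ⟨hy0, hy1, hy⟩
      simp only at hx
      rcases lt_trichotomy y x with h | h | h
      · have := root_strictAnti (n := g - 1) hy0 h
        linarith
      · exact h
      · have := root_strictAnti (n := g - 1) hx0 h
        linarith
    · rintro rfl
      exact ⟨hx0, hx1, hx⟩
  rw [xRoot, hs, csSup_singleton]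

theorem xRoot_mem {g : ℕ} (hg : 2 ≤ g) : xRoot g ∈ rootSet g := by
  rw [rootSet_eq_singleton hg]
  rfl

theorem xRoot_pos {g : ℕ} (hg : 2 ≤ g) : 0 < xRoot g := by
  obtain ⟨h0, -, h⟩ := xRoot_mem hg
  refine lt_of_le_of_ne h0 fun h1 => ?_
  rw [← h1, zero_pow (by omega)] at h
  norm_num at h

theorem xRoot_le_one {g : ℕ} (hg : 2 ≤ g) : xRoot g ≤ 1 := (xRoot_mem hg).2.1

theorem le_xRoot {g : ℕ} (hg : 2 ≤ g) {y : ℝ} (h : 0 ≤ 1 - y - y ^ (g - 1)) : y ≤ xRoot g := by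
  obtain ⟨h0, -, hx⟩ := xRoot_mem hg
  by_contra! hlt
  have := root_strictAnti (n := g - 1) h0 hlt
  linarith

theorem xRoot_le {g : ℕ} (hg : 2 ≤ g) {y : ℝ} (hy : 0 ≤ y) (h : 1 - y - y ^ (g - 1) ≤ 0) :
    xRoot g ≤ y := by
  obtain ⟨-, -, hx⟩ := xRoot_mem hg
  by_contra! hlt
  have := root_strictAnti (n := g - 1) hy hlt
  linarith

theorem one_sub_log_div_le_xRoot {g : ℕ} (hg : 2 ≤ g) :
    1 - Real.log g / ((g : ℝ) - 1) ≤ xRoot g := by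
  obtain ⟨n, rfl⟩ : ∃ n, g = n + 1 := ⟨g - 1, by omega⟩
  have hn : (0 : ℝ) < n := by
    have : 0 < n := by omega
    exact_mod_cast this
  refine le_xRoot hg ?_
  push_cast
  rw [add_sub_cancel_right]
  have hlog : Real.log (n + 1) ≤ n := by
    have := Real.log_le_sub_one_of_pos (show (0 : ℝ) < n + 1 by positivity)
    linarith
  have hy0 : 0 ≤ 1 - Real.log (n + 1) / n := by
    rw [sub_nonneg, div_le_one hn]
    exact hlog
  have hpow : (1 - Real.log (n + 1) / n) ^ n ≤ ((n : ℝ) + 1)⁻¹ := by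
    have h1 : 1 - Real.log (n + 1) / n ≤ Real.exp (-(Real.log (n + 1) / n)) :=
      Real.one_sub_le_exp_neg _
    refine (pow_le_pow_left₀ hy0 h1 n).trans (le_of_eq ?_)
    rw [← Real.exp_nat_mul, mul_neg, mul_div_cancel₀ _ hn.ne', Real.exp_neg,
      Real.exp_log (by positivity)]
  have hlow : ((n : ℝ) + 1)⁻¹ ≤ Real.log (n + 1) / n := by
    have := Real.one_sub_inv_le_log_of_pos (show (0 : ℝ) < n + 1 by positivity)
    rw [le_div_iff₀ hn]
    refine le_trans (le_of_eq ?_) this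
    field_simp
    ring
  linarith

theorem eventually_xRoot_le :
    ∀ᶠ g : ℕ in atTop, xRoot g ≤ 1 - 1 / ((g : ℝ) - 1) := by
  have h1 : Tendsto (fun n : ℕ => (1 + (-1) / (n : ℝ)) ^ n) atTop (𝓝 (Real.exp (-1))) :=
    Real.tendsto_one_add_div_pow_exp (-1)
  have h2 : Tendsto (fun n : ℕ => 1 / (n : ℝ)) atTop (𝓝 0) := tendsto_one_div_atTop_nhds_zero_nat
  have h3 := (h2.eventually_lt h1 (Real.exp_pos (-1))).and (eventually_ge_atTop 1)
  filter_upwards [(tendsto_sub_atTop_nat 1).eventually h3, eventually_ge_atTop 2] with g hg hg2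
  obtain ⟨n, rfl⟩ : ∃ n, g = n + 1 := ⟨g - 1, by omega⟩
  rw [Nat.add_sub_cancel] at hg
  have hn : (1 : ℝ) ≤ n := by exact_mod_cast hg.2
  refine xRoot_le hg2 ?_ ?_
  · push_cast
    rw [add_sub_cancel_right, sub_nonneg, div_le_one (by linarith)]
    exact hn
  · push_cast
    rw [add_sub_cancel_right]
    have h4 := hg.1
    rw [neg_div, ← sub_eq_add_neg] at h4
    linarith

theorem tendsto_xRoot : Tendsto xRoot atTop (𝓝 1) := by
  have h1 : Tendsto (fun g : ℕ => Real.log g / g) atTop (𝓝 0) :=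
    (Real.isLittleO_log_id_atTop.tendsto_div_nhds_zero).comp tendsto_natCast_atTop_atTop
  have h2 : Tendsto (fun g : ℕ => 1 - 2 * (Real.log g / g)) atTop (𝓝 1) := by
    simpa using (h1.const_mul 2).const_sub 1
  refine tendsto_of_tendsto_of_tendsto_of_le_of_le' h2 tendsto_const_nhds ?_ ?_
  · filter_upwards [eventually_ge_atTop 2] with g hg
    refine le_trans ?_ (one_sub_log_div_le_xRoot hg)
    have hg' : (2 : ℝ) ≤ g := by exact_mod_cast hg
    have hlog : 0 ≤ Real.log g := Real.log_nonneg (by linarith)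
    have : Real.log g / ((g : ℝ) - 1) ≤ 2 * (Real.log g / g) := by
      rw [← mul_div_assoc, div_le_div_iff₀ (by linarith) (by linarith)]
      nlinarith
    linarith
  · filter_upwards [eventually_ge_atTop 2] with g hg
    exact xRoot_le_one hg

/-! ### The competitive ratio -/

theorem opt_nonneg {α : Type u} {β : Type v} (G : Graph α β) [Fintype G.edgeSet] (w : β → ℝ) :
    0 ≤ opt G w := by
  have h : (∅ : Finset β) ∈ forestsIn G G.edgeSet.toFinset := by
    simp [forestsIn, isForest_empty]
  have h0 : weight w ∅ = 0 := Finset.sum_empty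
  exact h0 ▸ Finset.le_sup' (weight w) h

theorem isCompetitive {g : ℕ} (hg : 2 ≤ g) :
    IsCompetitive.{u, v} g (Real.exp 1 / xRoot g) := by
  have hx := xRoot_pos hg
  have he : (0 : ℝ) < Real.exp 1 := Real.exp_pos 1
  refine ⟨?_, ?_⟩
  · rw [le_div_iff₀ hx, one_mul]
    exact (xRoot_le_one hg).trans (Real.one_le_exp zero_le_one)
  intro α β _ _ G _ _ w forest hgirth hforest
  refine ⟨fun σ coin t => isForest_accepted t, ?_⟩
  rcases Nat.eq_zero_or_pos (numEdges G) with hm | hm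
  · have hopt : opt G w = 0 := by
      obtain ⟨F, hFE, -, hF⟩ := exists_isForest_weight_eq_opt G w
      have hempty : IsEmpty G.edgeSet := Fintype.card_eq_zero_iff.1 hm
      have : F = ∅ := Finset.eq_empty_of_forall_notMem fun e he => hempty.false ⟨e, hFE he⟩
      rw [← hF, this]
      simp [weight]
    have hout : ∀ σ coin, output G forest σ coin = ∅ := by
      intro σ coin
      have : ∀ n, n = 0 → (stateAfter G forest σ coin n).accepted = ∅ := by
        rintro n rfl
        rfl
      exact this _ hm
    simp [hopt, expectedGain, hout, weight]
  · have hmR : (0 : ℝ) < numEdges G := by exact_mod_cast hm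
    have h1 := mul_opt_le_expectedGain hforest hgirth (xRoot_mem hg)
    have h2 : (numEdges G : ℝ) / Real.exp 1 ≤ ∑ t ∈ Finset.Ico (sampleSize G) (numEdges G),
        if t = sampleSize G then 1 else (sampleSize G : ℝ) / t := div_exp_le_secretary_sum hm
    have h3 : xRoot g * ((numEdges G : ℝ) / Real.exp 1 * opt G w) ≤
        numEdges G * expectedGain G w forest (xRoot g) :=
      le_trans (mul_le_mul_of_nonneg_left
        (mul_le_mul_of_nonneg_right h2 (opt_nonneg G w)) hx.le) h1
    rw [div_mul_eq_mul_div, le_div_iff₀ hx]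
    refine le_of_mul_le_mul_left ?_ hmR
    calc (numEdges G : ℝ) * (opt G w * xRoot g)
        = Real.exp 1 * (xRoot g * ((numEdges G : ℝ) / Real.exp 1 * opt G w)) := by
          field_simp
      _ ≤ Real.exp 1 * (numEdges G * expectedGain G w forest (xRoot g)) :=
          mul_le_mul_of_nonneg_left h3 he.le
      _ = _ := by ring

end GraphicSecretary

theorem theorem2 :
    (∀ g : ℕ, 2 ≤ g → GraphicSecretary.rootSet g = {GraphicSecretary.xRoot g}) ∧
    (∀ g : ℕ, 2 ≤ g →
      GraphicSecretary.IsCompetitive.{u, v} g (Real.exp 1 / GraphicSecretary.xRoot g)) ∧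
    (∀ g : ℕ, 2 ≤ g → 1 - Real.log g / ((g : ℝ) - 1) ≤ GraphicSecretary.xRoot g) ∧
    (∀ᶠ g : ℕ in atTop, GraphicSecretary.xRoot g ≤ 1 - 1 / ((g : ℝ) - 1)) ∧
    Tendsto GraphicSecretary.xRoot atTop (𝓝 1) ∧
    Tendsto (fun g : ℕ => Real.exp 1 / GraphicSecretary.xRoot g) atTop (𝓝 (Real.exp 1)) ∧
    (∃ δ : ℕ → ℝ, δ =o[atTop] (fun _ => (1 : ℝ)) ∧ ∀ g : ℕ, 2 ≤ g → δ g < 1 ∧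
      GraphicSecretary.IsCompetitive.{u, v} g (1 / (1 / Real.exp 1 * (1 - δ g)))) := by
  refine ⟨fun g hg => GraphicSecretary.rootSet_eq_singleton hg,
    fun g hg => GraphicSecretary.isCompetitive hg,
    fun g hg => GraphicSecretary.one_sub_log_div_le_xRoot hg,
    GraphicSecretary.eventually_xRoot_le, GraphicSecretary.tendsto_xRoot, ?_,
    fun g => 1 - GraphicSecretary.xRoot g, ?_, fun g hg => ⟨?_, ?_⟩⟩
  · have h := (tendsto_const_nhds (x := Real.exp 1)).div GraphicSecretary.tendsto_xRoot one_ne_zero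
    rwa [div_one] at h
  · rw [isLittleO_one_iff]
    simpa using GraphicSecretary.tendsto_xRoot.const_sub 1
  · linarith [GraphicSecretary.xRoot_pos hg]
  · have h : 1 / (1 / Real.exp 1 * (1 - (1 - GraphicSecretary.xRoot g))) =
        Real.exp 1 / GraphicSecretary.xRoot g := by
      rw [sub_sub_cancel, one_div_mul_eq_div, one_div_div]
    rw [h]
    exact GraphicSecretary.isCompetitive hg
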